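/- Let $p$ be a prime and let $G$ be a non-abelian topological group isomorphic to a semidirect product $\Gamma_1\rtimes_\rho\Gamma_2$ of two copies $\Gamma_1,\Gamma_2$ of the additive group $\mathbb{Z}_p$, where $\Gamma_2$ acts on $\Gamma_1$ through a continuous homomorphism $\rho:\Gamma_2\to\mathrm{Aut}(\Gamma_1)\cong\mathbb{Z}_p^\times$. Let $\gamma_1,\gamma_2$ be the topological generators of $\Gamma_1,\Gamma_2$ that correspond to $1\in\mathbb{Z}_p$, and put $\epsilon=\rho(\gamma_2)$. If $p=2$, assume moreover that $\epsilon\neq-1$. Let $A=\mathbb{F}_p[[G]]=\varprojlim_U\mathbb{F}_p[G/U]$ ($U$ running through the open normal subgroups of $G$) be the completed group algebra, and put $X=\gamma_1-1$, $Y=\gamma_2-1$ in $A$. Let $\sigma$ be the endomorphism $X\mapsto(1+X)^\epsilon-1$ of $\mathbb{F}_p[[X]]$ and let $\delta=\sigma-\mathrm{id}$. Let $\mathbb{F}_p[[X,Y;\sigma,\delta]]$ be the skew power series ring of all formal series $\sum_{n\ge0}r_nY^n$ with $r_n\in\mathbb{F}_p[[X]]$, added coefficientwise and multiplied by $$\Big(\sum_i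 r_iY^i\Big)\Big(\sum_j s_jY^j\Big)=\sum_n\Big(\sum_{j=0}^{n}\sum_{i\ge n-j}r_i\,(Y^is_j)_{n-j}\Big)Y^n,$$ where the elements $(Y^is)_m\in\mathbb{F}_p[[X]]$ are defined by $Y^is=\sum_{m\le i}(Y^is)_mY^m$ and the rule $Yr=\sigma(r)Y+\delta(r)$. Then: 1. There is a ring isomorphism $A\cong\mathbb{F}_p[[X,Y;\sigma,\delta]]$ that maps $\gamma_1-1$ to $X$ and $\gamma_2-1$ to $Y$. 2. $A$ is a unique factorisation domain in the sense of Chatters: $A$ is a left and right Noetherian integral domain, it has at least one prime ideal of height one, and every height-one prime ideal $P$ of $A$ is principal, i.e. $P=aA=Aa$ for some $a\in A$, with $A/P$ an integral domain. 3. The two-sided ideal $(X)=AXA$ is the only prime ideal of height one in $A$. 4. $X$ is, up to multiplication by units (on the left or on the right), the only prime element of $A$; here a prime element is a nonzero $a\in A$ for which $aA=Aa$ is a prime ideal. (Ideals are two-sided; the height of a prime ideal is the supremum of the lengths of the chains of prime ideals that end in it.) -/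

import Mathlib

open scoped PowerSeries.WithPiTopology

/-! ### Completed group algebras -/

/-- The completed group algebra `k[[G]]`: the inverse limit of the group algebras `k[G/U]`, where
`U` runs through the open normal subgroups of `G`, along the canonical projections. -/
noncomputable def CompletedGroupAlgebra (k G : Type*) [Ring k] [Group G] [TopologicalSpace G] :
    Subring (∀ U : OpenNormalSubgroup G, MonoidAlgebra k (G ⧸ U.toSubgroup)) where
  carrier := {f | ∀ (U V : OpenNormalSubgroup G) (h : U.toSubgroup ≤ V.toSubgroup),
    MonoidAlgebra.mapDomainRingHom k
      (QuotientGroup.map U.toSubgroup V.toSubgroup (MonoidHom.id G) h) (f U) = f V}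
  mul_mem' := by
    intro a b ha hb U V h
    rw [Pi.mul_apply, map_mul, ha U V h, hb U V h, Pi.mul_apply]
  one_mem' := by
    intro U V h
    rw [Pi.one_apply, map_one, Pi.one_apply]
  add_mem' := by
    intro a b ha hb U V h
    rw [Pi.add_apply, map_add, ha U V h, hb U V h, Pi.add_apply]
  zero_mem' := by
    intro U V h
    rw [Pi.zero_apply, map_zero, Pi.zero_apply]
  neg_mem' := by
    intro a ha U V h
    rw [Pi.neg_apply, map_neg, ha U V h, Pi.neg_apply]

/-- The image of a group element `g` in the completed group algebra. -/
noncomputable def CompletedGroupAlgebra.of (k : Type*) {G : Type*} [Ring k] [Group G]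
    [TopologicalSpace G] (g : G) : CompletedGroupAlgebra k G :=
  ⟨fun U => MonoidAlgebra.of k (G ⧸ U.toSubgroup) (QuotientGroup.mk g), by
    intro U V h
    simp only [MonoidAlgebra.of_apply, MonoidAlgebra.mapDomainRingHom_apply,
      MonoidAlgebra.mapDomain_single]
    rfl⟩

/-! ### Semidirect products of two copies of the `p`-adic integers -/

/-- The action of `ℤ_p` on `ℤ_p` by automorphisms attached to a continuous homomorphism
`ρ : ℤ_p → ℤ_pˣ = Aut(ℤ_p)`: the element `b` acts as multiplication by `ρ b`. -/
noncomputable def padicAction (p : ℕ) [Fact p.Prime] (ρ : Multiplicative ℤ_[p] →ₜ* ℤ_[p]ˣ) :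
    Multiplicative ℤ_[p] →* MulAut (Multiplicative ℤ_[p]) where
  toFun b := AddEquiv.toMultiplicative (DistribMulAction.toAddEquiv ℤ_[p] (ρ b))
  map_one' := by
    ext a
    simp
  map_mul' b c := by
    ext a
    simp [mul_smul]

/-- The semidirect product `ℤ_p ⋊ ℤ_p` in which the second factor acts on the first by `ρ`. -/
abbrev PadicSemidirect (p : ℕ) [Fact p.Prime] (ρ : Multiplicative ℤ_[p] →ₜ* ℤ_[p]ˣ) : Type :=
  Multiplicative ℤ_[p] ⋊[padicAction p ρ] Multiplicative ℤ_[p]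

/-- `ℤ_p ⋊ ℤ_p` carries the product topology. -/
noncomputable instance PadicSemidirect.topologicalSpace (p : ℕ) [Fact p.Prime]
    (ρ : Multiplicative ℤ_[p] →ₜ* ℤ_[p]ˣ) : TopologicalSpace (PadicSemidirect p ρ) :=
  TopologicalSpace.induced SemidirectProduct.equivProd inferInstance

/-! ### Skew power series -/

/-- The coefficient `(Yⁿ r)_m` in `Yⁿ r = ∑_{m ≤ n} (Yⁿ r)_m Yᵐ`, computed from the rule
`Y r = σ(r) Y + δ(r)`. -/
def skewCoeff {R : Type*} [Ring R] (σ : R →+* R) (δ : R →+ R) : ℕ → R → ℕ → R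
  | 0, r, 0 => r
  | 0, _, _ + 1 => 0
  | n + 1, r, 0 => δ (skewCoeff σ δ n r 0)
  | n + 1, r, m + 1 => σ (skewCoeff σ δ n r m) + δ (skewCoeff σ δ n r (m + 1))

/-- The set `R[[Y;σ,δ]]` of formal power series `∑ rₙ Yⁿ` with coefficients on the left. -/
@[ext]
structure SkewPowerSeries {R : Type*} [Ring R] (σ : R →+* R) (δ : R →+ R) where
  coeff : ℕ → R

namespace SkewPowerSeries

variable {R : Type*} [Ring R] {σ : R →+* R} {δ : R →+ R}

/-- Power series are added coefficientwise. -/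
instance : Add (SkewPowerSeries σ δ) := ⟨fun f g => ⟨fun n => f.coeff n + g.coeff n⟩⟩

/-- The product `(∑ rᵢ Yⁱ) (∑ sⱼ Yʲ) = ∑ cₙ Yⁿ` with
`cₙ = ∑_{j ≤ n} ∑_{i ≥ n - j} rᵢ (Yⁱ sⱼ)_{n-j}`; the inner sums are limits in `R`. -/
noncomputable instance [TopologicalSpace R] : Mul (SkewPowerSeries σ δ) :=
  ⟨fun f g => ⟨fun n => ∑ j ∈ Finset.range (n + 1),
    ∑' i : ℕ, f.coeff (n - j + i) * skewCoeff σ δ (n - j + i) (g.coeff j) (n - j)⟩⟩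

/-- The constant power series `r`. -/
def C (σ : R →+* R) (δ : R →+ R) (r : R) : SkewPowerSeries σ δ :=
  ⟨fun n => if n = 0 then r else 0⟩

/-- The variable `Y`. -/
def Y (σ : R →+* R) (δ : R →+ R) : SkewPowerSeries σ δ := ⟨fun n => if n = 1 then 1 else 0⟩

end SkewPowerSeries

/-- The power series `(1 + X)^ε - 1` over `𝔽_p`, for a `p`-adic integer `ε`. -/
noncomputable def powSubOne (p : ℕ) [Fact p.Prime] (ε : ℤ_[p]) : PowerSeries (ZMod p) :=
  (PowerSeries.binomialSeries ℤ_[p] ε).map PadicInt.toZMod - 1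

theorem hasSubst_powSubOne (p : ℕ) [Fact p.Prime] (ε : ℤ_[p]) :
    PowerSeries.HasSubst (powSubOne p ε) := by
  apply PowerSeries.HasSubst.of_constantCoeff_zero'
  rw [powSubOne, map_sub, ← PowerSeries.coeff_zero_eq_constantCoeff_apply, PowerSeries.coeff_map]
  simp

/-- The endomorphism `σ` of `𝔽_p[[X]]` given by `X ↦ (1 + X)^ε - 1`. -/
noncomputable def sigmaHom (p : ℕ) [Fact p.Prime] (ε : ℤ_[p]) :
    PowerSeries (ZMod p) →+* PowerSeries (ZMod p) :=
  (PowerSeries.substAlgHom (R := ZMod p) (hasSubst_powSubOne p ε)).toRingHom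

/-- The `σ`-derivation `δ = σ - id` of `𝔽_p[[X]]`. -/
noncomputable def deltaHom (p : ℕ) [Fact p.Prime] (ε : ℤ_[p]) :
    PowerSeries (ZMod p) →+ PowerSeries (ZMod p) :=
  (sigmaHom p ε : PowerSeries (ZMod p) →+ PowerSeries (ZMod p)) - AddMonoidHom.id _

/-- The ring `𝔽_p[[X,Y;σ,δ]] = 𝔽_p[[X]][[Y;σ,δ]]`, where `σ(X) = (1 + X)^ε - 1` and
`δ = σ - id`; the topology of `𝔽_p[[X]]` is the `X`-adic one. -/
abbrev SkewFpSeries (p : ℕ) [Fact p.Prime] (ε : ℤ_[p]) : Type :=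
  SkewPowerSeries (sigmaHom p ε) (deltaHom p ε)

/-! The sums in the definition of the product converge in `𝔽_p[[X,Y;σ,δ]]` whenever `ε ≡ 1 mod p`,
and this congruence holds for every `ε = ρ(1)` as above. -/

theorem toZMod_padicAction_one (p : ℕ) [Fact p.Prime] (ρ : Multiplicative ℤ_[p] →ₜ* ℤ_[p]ˣ) :
    PadicInt.toZMod (ρ (Multiplicative.ofAdd 1) : ℤ_[p]) = 1 := by
  have hp : p.Prime := Fact.out
  have hu : IsUnit (((p - 1 : ℕ) : ℤ_[p])) := by
    rw [PadicInt.isUnit_iff]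
    by_contra h
    have h1 : ‖((p - 1 : ℕ) : ℤ_[p])‖ < 1 := lt_of_le_of_ne (PadicInt.norm_le_one _) h
    have h2 : ((p - 1 : ℕ) : ℤ_[p]) = (((p - 1 : ℕ) : ℤ) : ℤ_[p]) := by simp
    rw [h2, PadicInt.norm_int_lt_one_iff_dvd] at h1
    have h3 : p ∣ p - 1 := by exact_mod_cast h1
    have := Nat.le_of_dvd (by have := hp.two_le; omega) h3
    have := hp.two_le
    omega
  obtain ⟨u, hu⟩ := hu
  have h : (Multiplicative.ofAdd (1 : ℤ_[p])) =
      (Multiplicative.ofAdd ((↑u⁻¹ : ℤ_[p]))) ^ (p - 1) := by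
    rw [← ofAdd_nsmul, nsmul_eq_mul, ← hu, Units.mul_inv]
  rw [h, map_pow, Units.val_pow_eq_pow_val, map_pow]
  apply ZMod.pow_card_sub_one_eq_one
  exact ((Units.isUnit _).map PadicInt.toZMod).ne_zero

theorem powSubOne_eq (p : ℕ) [Fact p.Prime] (ε : ℤ_[p]) (hε : PadicInt.toZMod ε = 1) :
    ∃ w : PowerSeries (ZMod p), powSubOne p ε = PowerSeries.X * (1 + PowerSeries.X * w) := by
  have h : PowerSeries.X ^ 2 ∣ powSubOne p ε - PowerSeries.X := by
    rw [PowerSeries.X_pow_dvd_iff]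
    intro m hm
    interval_cases m
    · rw [powSubOne, map_sub, map_sub, PowerSeries.coeff_map]
      simp
    · simp [powSubOne, PowerSeries.coeff_one, PowerSeries.coeff_X, hε]
  obtain ⟨w, hw⟩ := h
  exact ⟨w, by linear_combination hw⟩

theorem sigmaHom_X (p : ℕ) [Fact p.Prime] (ε : ℤ_[p]) :
    sigmaHom p ε PowerSeries.X = powSubOne p ε :=
  PowerSeries.substAlgHom_X (hasSubst_powSubOne p ε)

theorem X_dvd_sigmaHom_sub (p : ℕ) [Fact p.Prime] (ε : ℤ_[p]) (g : PowerSeries (ZMod p))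
    (hε : PadicInt.toZMod ε = 1) : PowerSeries.X ∣ sigmaHom p ε g - g := by
  obtain ⟨w, hw⟩ := powSubOne_eq p ε hε
  obtain ⟨h, hh⟩ : PowerSeries.X ∣ g - PowerSeries.C (PowerSeries.constantCoeff g) := by
    rw [PowerSeries.X_dvd_iff]
    simp
  have hg : g = PowerSeries.C (PowerSeries.constantCoeff g) + PowerSeries.X * h := by
    linear_combination hh
  have hC : sigmaHom p ε (PowerSeries.C (PowerSeries.constantCoeff g)) =
      PowerSeries.C (PowerSeries.constantCoeff g) :=
    (PowerSeries.substAlgHom (R := ZMod p) (hasSubst_powSubOne p ε)).commutes _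
  refine ⟨(1 + PowerSeries.X * w) * sigmaHom p ε h - h, ?_⟩
  conv_lhs => rw [hg]
  rw [map_add, map_mul, sigmaHom_X, hC, hw]
  ring

theorem X_pow_dvd_sigmaHom (p : ℕ) [Fact p.Prime] (ε : ℤ_[p]) (k : ℕ) (f : PowerSeries (ZMod p))
    (hε : PadicInt.toZMod ε = 1) (hf : PowerSeries.X ^ k ∣ f) :
    PowerSeries.X ^ k ∣ sigmaHom p ε f := by
  obtain ⟨w, hw⟩ := powSubOne_eq p ε hε
  obtain ⟨g, rfl⟩ := hf
  refine ⟨(1 + PowerSeries.X * w) ^ k * sigmaHom p ε g, ?_⟩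
  rw [map_mul, map_pow, sigmaHom_X, hw, mul_pow]
  ring

theorem X_pow_dvd_deltaHom (p : ℕ) [Fact p.Prime] (ε : ℤ_[p]) (k : ℕ) (f : PowerSeries (ZMod p))
    (hε : PadicInt.toZMod ε = 1) (hf : PowerSeries.X ^ k ∣ f) :
    PowerSeries.X ^ (k + 1) ∣ deltaHom p ε f := by
  obtain ⟨w, hw⟩ := powSubOne_eq p ε hε
  obtain ⟨g, rfl⟩ := hf
  obtain ⟨h, hh⟩ := X_dvd_sigmaHom_sub p ε g hε
  obtain ⟨v, hv⟩ : PowerSeries.X ∣ (1 + PowerSeries.X * w) ^ k - 1 := by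
    rw [PowerSeries.X_dvd_iff]
    simp
  refine ⟨v * sigmaHom p ε g + h, ?_⟩
  change sigmaHom p ε (PowerSeries.X ^ k * g) - PowerSeries.X ^ k * g = _
  rw [map_mul, map_pow, sigmaHom_X, hw, mul_pow]
  linear_combination PowerSeries.X ^ k * hh + PowerSeries.X ^ k * sigmaHom p ε g * hv

theorem X_pow_dvd_skewCoeff (p : ℕ) [Fact p.Prime] (ε : ℤ_[p]) (hε : PadicInt.toZMod ε = 1)
    (n : ℕ) (r : PowerSeries (ZMod p)) (m : ℕ) :
    PowerSeries.X ^ (n - m) ∣ skewCoeff (sigmaHom p ε) (deltaHom p ε) n r m := by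
  induction n generalizing m with
  | zero => simp
  | succ n ih =>
    cases m with
    | zero => exact X_pow_dvd_deltaHom p ε n _ hε (by simpa using ih 0)
    | succ m =>
      rw [Nat.add_sub_add_right]
      refine dvd_add (X_pow_dvd_sigmaHom p ε _ _ hε (ih m)) ?_
      exact (pow_dvd_pow _ (by omega)).trans (X_pow_dvd_deltaHom p ε _ _ hε (ih (m + 1)))

theorem summable_skewFpSeries_mul (p : ℕ) [Fact p.Prime] (ε : ℤ_[p])
    (hε : PadicInt.toZMod ε = 1) (f g : SkewFpSeries p ε) (m j : ℕ) :
    Summable fun i : ℕ => f.coeff (m + i) *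
      skewCoeff (sigmaHom p ε) (deltaHom p ε) (m + i) (g.coeff j) m := by
  rw [PowerSeries.WithPiTopology.summable_iff_summable_coeff]
  intro d
  refine summable_of_hasFiniteSupport ((Set.finite_Iic d).subset fun i hi => ?_)
  by_contra hid
  apply hi
  have h := X_pow_dvd_skewCoeff p ε hε (m + i) (g.coeff j) m
  rw [Nat.add_sub_cancel_left] at h
  exact PowerSeries.X_pow_dvd_iff.mp (h.mul_left (f.coeff (m + i))) d (by simpa using hid)

/-! ### Noncommutative unique factorisation domains -/

section UFD

variable {A : Type*} [Ring A]

/-- A two-sided ideal `P ≠ A` is prime if `aAb ⊆ P` implies `a ∈ P` or `b ∈ P`. -/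
def IsPrimeTwoSided (P : TwoSidedIdeal A) : Prop :=
  P ≠ ⊤ ∧ ∀ a b : A, (∀ x : A, a * x * b ∈ P) → a ∈ P ∨ b ∈ P

/-- `P` is a prime ideal of height one, the height being the supremum of the lengths of the chains
of prime ideals ending in `P`. -/
def IsHeightOnePrime (P : TwoSidedIdeal A) : Prop :=
  ∃ h : IsPrimeTwoSided P,
    Order.height (⟨P, h⟩ : {Q : TwoSidedIdeal A // IsPrimeTwoSided Q}) = 1

/-- `P = aA = Aa`. -/
def IsGeneratedByNormal (P : TwoSidedIdeal A) (a : A) : Prop :=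
  (∀ y : A, y ∈ P ↔ ∃ x : A, y = a * x) ∧ (∀ y : A, y ∈ P ↔ ∃ x : A, y = x * a)

/-- A prime element: a nonzero (normal) element `a` such that `aA = Aa` is a prime ideal. -/
def IsPrimeElement (a : A) : Prop :=
  a ≠ 0 ∧ ∃ P : TwoSidedIdeal A, IsPrimeTwoSided P ∧ IsGeneratedByNormal P a

/-- Unique factorisation domains in the sense of Chatters: left and right Noetherian integral
domains with at least one height-one prime in which every height-one prime `P` is principal,
`P = aA = Aa`, with `A/P` an integral domain. -/
structure IsChattersUFD (A : Type*) [Ring A] : Prop where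
  isDomain : IsDomain A
  isNoetherian_left : IsNoetherianRing A
  isNoetherian_right : IsNoetherianRing Aᵐᵒᵖ
  exists_heightOne : ∃ P : TwoSidedIdeal A, IsHeightOnePrime P
  principal : ∀ P : TwoSidedIdeal A, IsHeightOnePrime P → ∃ a : A, IsGeneratedByNormal P a
  isDomain_quotient : ∀ P : TwoSidedIdeal A, IsHeightOnePrime P → IsDomain P.ringCon.Quotient

end UFD

/-!
Write `R = 𝔽_p[[X]]`, `S = 𝔽_p[[X,Y;σ,δ]]` and `A = 𝔽_p[[G]]`.

**The isomorphism.** The elements of `G` both of whose coordinates are divisible by `p^m` form open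
normal subgroups `U_m` (`congruenceSubgroup`), and these are cofinal among all open normal
subgroups. In `𝔽_p[G/U_m]` the elements `x = γ₁ - 1` and `y = γ₂ - 1` satisfy
`x^{p^m} = y^{p^m} = 0`, so power series in `x` and skew power series in `x, y` have values there.
Since `γ₁^z = (1 + x)^z` for all `z ∈ ℤ_p` (`nilEval_onePlusXPow`), the relation
`γ₂ γ₁ γ₂⁻¹ = γ₁^ε` becomes `(1 + y) r(x) = σ(r)(x) (1 + y)` (`toLevel_mul_nilEval`), which makes
evaluation multiplicative (`skewEval_mul`). The `p^{2m}` monomials `x^k y^l` with `k, l < p^m` span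
`𝔽_p[G/U_m]`, whose dimension is `p^{2m}`, so they form a basis; hence the evaluations at all levels
fit together to a bijection `S → A` (`completedEvalEquiv`).

**Ring theory.** In `A` the element `X` is regular and commutes with everything modulo `X²`, the
quotient by it is the principal ideal domain `𝔽_p[[Y]]`, and `A` is separated and complete for the
`X`-adic topology (`isNormalUniformizer_skewConst_X`). By successive approximation `XA = AX`, `A` is
a domain, and `A` is left Noetherian (`IsNormalUniformizer.isNoetherianRing`); these properties of
`X` pass to the opposite ring, so `A` is right Noetherian as well. The ideal `(X)` is completely
prime.

**Prime ideals.** A nonzero prime `P` contains `X`. Otherwise `P` contains an element that is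
nonzero modulo `X`, and Weierstrass division by it yields a monic polynomial in `γ₂` with
coefficients in `R` that lies in `P`. The twisted commutators `f X - σᵈ(X) f` remove the terms of
such a polynomial one by one (`TwoSidedIdeal.exists_ne_zero_mem_of_eval₂_mem`), because
`γ₂ⁿ X = σⁿ(X) γ₂ⁿ` and the series `σⁿ(X) = (1 + X)^{εⁿ} - 1` are pairwise distinct. Here it matters
that `ε` is not a root of unity: `ε` is a principal unit, it is not `1` because `G` is not abelian,
and it is not `-1` if `p = 2`. So `P` contains a nonzero element of `R`, hence a power of `X`, hence
`X`. It follows that `(X)` is the only prime of height one and that a prime element generates `(X)`.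
-/

/-! ### The `p`-adic powers of `1 + X` -/

section Binomial

variable (p : ℕ) [Fact p.Prime]

/-- The power series `(1 + X)^z` over `𝔽_p`, for a `p`-adic integer `z`. -/
noncomputable def onePlusXPow (z : ℤ_[p]) : PowerSeries (ZMod p) :=
  (PowerSeries.binomialSeries ℤ_[p] z).map PadicInt.toZMod

theorem powSubOne_eq_onePlusXPow_sub_one (ε : ℤ_[p]) : powSubOne p ε = onePlusXPow p ε - 1 := rfl

theorem onePlusXPow_zero : onePlusXPow p 0 = 1 := by
  simp [onePlusXPow]

theorem onePlusXPow_add (z w : ℤ_[p]) :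
    onePlusXPow p (z + w) = onePlusXPow p z * onePlusXPow p w := by
  simp [onePlusXPow]

theorem onePlusXPow_natCast (n : ℕ) : onePlusXPow p (n : ℤ_[p]) = (1 + PowerSeries.X) ^ n := by
  simp [onePlusXPow]

theorem onePlusXPow_nsmul (n : ℕ) (z : ℤ_[p]) :
    onePlusXPow p (n * z) = onePlusXPow p z ^ n := by
  induction n with
  | zero => simp [onePlusXPow_zero]
  | succ n ih => rw [Nat.cast_succ, add_mul, one_mul, onePlusXPow_add, ih, pow_succ]

theorem constantCoeff_onePlusXPow (z : ℤ_[p]) :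
    PowerSeries.constantCoeff (onePlusXPow p z) = 1 := by
  simp [onePlusXPow, ← PowerSeries.coeff_zero_eq_constantCoeff_apply, PowerSeries.coeff_map]

theorem coeff_one_onePlusXPow (z : ℤ_[p]) :
    PowerSeries.coeff 1 (onePlusXPow p z) = PadicInt.toZMod z := by
  simp [onePlusXPow, PowerSeries.coeff_map]

instance : CharP (PowerSeries (ZMod p)) p :=
  charP_of_injective_algebraMap (PowerSeries.C_injective (R := ZMod p)) p

/-- By the Frobenius, `(1 + X)^z` is congruent to `1` modulo `X^{p^m}` when `p^m ∣ z`. -/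
theorem onePlusXPow_pow_mul (m : ℕ) (z : ℤ_[p]) :
    onePlusXPow p ((p : ℤ_[p]) ^ m * z) - 1 = (onePlusXPow p z - 1) ^ p ^ m := by
  rw [← Nat.cast_pow, onePlusXPow_nsmul, sub_pow_char_pow, one_pow]

theorem X_dvd_onePlusXPow_sub_one (z : ℤ_[p]) : PowerSeries.X ∣ onePlusXPow p z - 1 := by
  rw [PowerSeries.X_dvd_iff]
  simp [constantCoeff_onePlusXPow]

theorem X_pow_dvd_onePlusXPow_sub (m : ℕ) (z w : ℤ_[p]) (h : (p : ℤ_[p]) ^ m ∣ z - w) :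
    PowerSeries.X ^ p ^ m ∣ onePlusXPow p z - onePlusXPow p w := by
  obtain ⟨t, ht⟩ := h
  have hz : z = w + (p : ℤ_[p]) ^ m * t := by rw [← ht]; ring
  have h1 : onePlusXPow p z - onePlusXPow p w =
      onePlusXPow p w * (onePlusXPow p ((p : ℤ_[p]) ^ m * t) - 1) := by
    rw [hz, onePlusXPow_add]; ring
  rw [h1, onePlusXPow_pow_mul]
  exact (pow_dvd_pow_of_dvd (X_dvd_onePlusXPow_sub_one p t) _).mul_left _

theorem onePlusXPow_injective : Function.Injective (onePlusXPow p) := by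
  intro z w h
  by_contra hne
  obtain ⟨d, hd⟩ : ∃ d, d = z - w := ⟨_, rfl⟩
  have hd0 : d ≠ 0 := by rw [hd]; exact sub_ne_zero.mpr hne
  have hz : z = d + w := by rw [hd]; ring
  have hu : IsUnit (onePlusXPow p w) := by
    rw [PowerSeries.isUnit_iff_constantCoeff, constantCoeff_onePlusXPow]
    exact isUnit_one
  have h1 : onePlusXPow p d = 1 := by
    rw [hz, onePlusXPow_add] at h
    exact hu.mul_left_injective (by simpa using h)
  have h2 : d = (p : ℤ_[p]) ^ d.valuation * PadicInt.unitCoeff hd0 := by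
    rw [mul_comm]; exact PadicInt.unitCoeff_spec hd0
  rw [← sub_eq_zero, h2, onePlusXPow_pow_mul, ] at h1
  have h3 := congrArg (PowerSeries.coeff 1) (eq_zero_of_pow_eq_zero h1)
  rw [map_sub, coeff_one_onePlusXPow] at h3
  simp only [PowerSeries.coeff_one, one_ne_zero, if_false, sub_zero, map_zero] at h3
  exact ((Units.isUnit (PadicInt.unitCoeff hd0)).map PadicInt.toZMod).ne_zero h3

theorem sub_appr_dvd (z : ℤ_[p]) (m : ℕ) : (p : ℤ_[p]) ^ m ∣ z - (z.appr m : ℤ_[p]) :=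
  Ideal.mem_span_singleton.mp (PadicInt.appr_spec m z)

variable {p}

theorem eq_of_forall_X_pow_dvd_sub {f g : PowerSeries (ZMod p)}
    (h : ∀ m, PowerSeries.X ^ p ^ m ∣ f - g) : f = g := by
  rw [← sub_eq_zero]
  ext d
  have hp : 1 < p := (Fact.out : p.Prime).one_lt
  exact PowerSeries.X_pow_dvd_iff.mp (h d) d (Nat.lt_pow_self hp)

variable (p)

theorem sigmaHom_onePlusXPow (ε : ℤ_[p]) (hε : PadicInt.toZMod ε = 1) (z : ℤ_[p]) :
    sigmaHom p ε (onePlusXPow p z) = onePlusXPow p (ε * z) := by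
  have hnat (n : ℕ) : sigmaHom p ε (onePlusXPow p n) = onePlusXPow p (ε * n) := by
    rw [onePlusXPow_natCast, map_pow, map_add, map_one, sigmaHom_X,
      powSubOne_eq_onePlusXPow_sub_one, add_sub_cancel, mul_comm, onePlusXPow_nsmul]
  -- both sides depend continuously on `z`, and they agree for natural numbers
  refine eq_of_forall_X_pow_dvd_sub fun m => ?_
  have h1 := X_pow_dvd_sigmaHom p ε _ _ hε
    (X_pow_dvd_onePlusXPow_sub p m _ _ (sub_appr_dvd p z m))
  have h2 : (p : ℤ_[p]) ^ m ∣ ε * z - ε * (z.appr m : ℤ_[p]) := by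
    rw [← mul_sub]; exact (sub_appr_dvd p z m).mul_left _
  have h3 := X_pow_dvd_onePlusXPow_sub p m _ _ h2
  rw [map_sub, hnat] at h1
  simpa using dvd_sub h1 h3

theorem sigmaHom_iterate_X (ε : ℤ_[p]) (hε : PadicInt.toZMod ε = 1) (n : ℕ) :
    (sigmaHom p ε)^[n] PowerSeries.X = onePlusXPow p (ε ^ n) - 1 := by
  induction n with
  | zero =>
    have := onePlusXPow_natCast p 1
    simp only [Nat.cast_one, pow_one] at this
    simp [this]
  | succ n ih =>
    rw [Function.iterate_succ_apply', ih, map_sub, map_one, sigmaHom_onePlusXPow p ε hε, pow_succ']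

theorem sigmaHom_C (ε : ℤ_[p]) (a : ZMod p) :
    sigmaHom p ε (PowerSeries.C a) = PowerSeries.C a :=
  (PowerSeries.substAlgHom (R := ZMod p) (hasSubst_powSubOne p ε)).commutes _

end Binomial

/-! ### Roots of unity among the `p`-adic units -/

section RootsOfUnity

variable {p : ℕ} [Fact p.Prime]

theorem dvd_sub_one_of_toZMod_eq_one {z : ℤ_[p]} (h : PadicInt.toZMod z = 1) :
    (p : ℤ_[p]) ∣ z - 1 := by
  have : z - 1 ∈ RingHom.ker (PadicInt.toZMod (p := p)) := by simp [RingHom.mem_ker, h]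
  rw [PadicInt.ker_toZMod, PadicInt.maximalIdeal_eq_span_p] at this
  exact Ideal.mem_span_singleton.mp this

/-- Raising a principal unit to the power `p^m` brings it within `p^{m+1}` of `1`. -/
theorem pow_dvd_pow_sub_one {z : ℤ_[p]} (h : PadicInt.toZMod z = 1) (m : ℕ) :
    (p : ℤ_[p]) ^ (m + 1) ∣ z ^ p ^ m - 1 := by
  have := dvd_sub_pow_of_dvd_sub (dvd_sub_one_of_toZMod_eq_one h) m
  simpa using this

theorem eq_one_of_pow_eq_one_of_not_dvd {z : ℤ_[p]} (h : PadicInt.toZMod z = 1) {n : ℕ}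
    (hn : ¬ p ∣ n) (hz : z ^ n = 1) : z = 1 := by
  have h1 : (∑ i ∈ Finset.range n, z ^ i) * (z - 1) = 0 := by rw [geom_sum_mul, hz, sub_self]
  rcases mul_eq_zero.mp h1 with h2 | h2
  · exfalso
    have h3 := congrArg PadicInt.toZMod h2
    simp only [map_sum, map_pow, h, one_pow, Finset.sum_const, Finset.card_range, map_zero,
      nsmul_eq_mul, mul_one] at h3
    exact hn ((ZMod.natCast_eq_zero_iff n p).mp h3)
  · exact sub_eq_zero.mp h2

/-- A principal unit that is a root of unity is `1`, except that `-1` also occurs for `p = 2`. -/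
theorem eq_one_of_pow_eq_one {z : ℤ_[p]} (h : PadicInt.toZMod z = 1) (h2 : p = 2 → z ≠ -1)
    {n : ℕ} (hn : n ≠ 0) (hz : z ^ n = 1) : z = 1 := by
  obtain ⟨k, m, hm, rfl⟩ := Nat.exists_eq_pow_mul_and_not_dvd hn p (Fact.out : p.Prime).ne_one
  rw [pow_mul] at hz
  have hk : z ^ p ^ k = 1 := eq_one_of_pow_eq_one_of_not_dvd (by rw [map_pow, h, one_pow]) hm hz
  clear hz hn hm
  have hp0 : (p : ℤ_[p]) ≠ 0 := by exact_mod_cast (Fact.out : p.Prime).ne_zero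
  induction k with
  | zero => simpa using hk
  | succ k ih =>
    apply ih
    rw [pow_succ, pow_mul] at hk
    have hcontra : ¬ (p : ℤ_[p]) ^ 2 ∣ p := by
      intro h3
      rw [pow_two] at h3
      nth_rw 3 [← mul_one (p : ℤ_[p])] at h3
      obtain ⟨t, ht⟩ := (mul_dvd_mul_iff_left hp0).mp h3
      simpa using congrArg PadicInt.toZMod ht
    rcases (Fact.out : p.Prime).eq_two_or_odd' with hp | hp
    · subst hp
      rcases mul_self_eq_one_iff.mp ((pow_two _).symm.trans hk) with h3 | h3
      · exact h3
      · exfalso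
        obtain - | k := k
        · exact h2 rfl (by simpa using h3)
        · apply hcontra
          have h4 := pow_dvd_pow_sub_one h (k + 1)
          rw [h3, show ((-1 : ℤ_[2]) - 1) = -((2 : ℕ) : ℤ_[2]) by norm_num, dvd_neg] at h4
          exact (pow_dvd_pow _ (by omega)).trans h4
    · obtain ⟨t, ht⟩ := dvd_sub_one_of_toZMod_eq_one (z := z ^ p ^ k) (by rw [map_pow, h, one_pow])
      have h3 := odd_sq_dvd_geom_sum₂_sub (a := (1 : ℤ_[p])) (b := t) hp
      have h4 : (∑ i ∈ Finset.range p, (z ^ p ^ k) ^ i) * (z ^ p ^ k - 1) = 0 := by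
        rw [geom_sum_mul, hk, sub_self]
      rcases mul_eq_zero.mp h4 with h5 | h5
      · exfalso
        simp only [one_pow, mul_one] at h3
        rw [← ht, add_sub_cancel, h5, zero_sub, dvd_neg] at h3
        exact hcontra h3
      · exact sub_eq_zero.mp h5

end RootsOfUnity

/-! ### Coefficients of products of skew power series -/

section SkewCoeff

variable (p : ℕ) [Fact p.Prime]

theorem X_pow_dvd_tsum_sub_sum (g : ℕ → PowerSeries (ZMod p)) (hg : ∀ i, PowerSeries.X ^ i ∣ g i)
    (N : ℕ) : PowerSeries.X ^ N ∣ (∑' i, g i) - ∑ i ∈ Finset.range N, g i := by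
  have hs : Summable g := by
    rw [PowerSeries.WithPiTopology.summable_iff_summable_coeff]
    intro d
    refine summable_of_hasFiniteSupport ((Set.finite_Iic d).subset fun i hi => ?_)
    by_contra hid
    exact hi (PowerSeries.X_pow_dvd_iff.mp (hg i) d (by simpa using hid))
  rw [← hs.sum_add_tsum_nat_add N, add_sub_cancel_left, PowerSeries.X_pow_dvd_iff]
  intro d hd
  have hs' : Summable fun i => g (i + N) := (summable_nat_add_iff N).mpr hs
  rw [(hs'.map_tsum (PowerSeries.coeff (R := ZMod p) d)
    (PowerSeries.WithPiTopology.continuous_coeff (ZMod p) d))]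
  have h0 (i : ℕ) : PowerSeries.coeff d (g (i + N)) = 0 :=
    PowerSeries.X_pow_dvd_iff.mp (hg (i + N)) d (by omega)
  simp [h0]

theorem skewCoeff_zero {R : Type*} [Ring R] (σ : R →+* R) (δ : R →+ R) (n m : ℕ) :
    skewCoeff σ δ n 0 m = 0 := by
  induction n generalizing m with
  | zero => cases m <;> rfl
  | succ n ih => cases m <;> simp [skewCoeff, ih]

theorem skewCoeff_eq_zero_of_lt {R : Type*} [Ring R] (σ : R →+* R) (δ : R →+ R) (r : R)
    {n m : ℕ} (h : n < m) : skewCoeff σ δ n r m = 0 := by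
  induction n generalizing m with
  | zero => obtain - | m := m; · omega
            rfl
  | succ n ih =>
    obtain - | m := m
    · omega
    · rw [skewCoeff, ih (by omega), ih (by omega), map_zero, map_zero, add_zero]

theorem skewCoeff_self {R : Type*} [Ring R] (σ : R →+* R) (δ : R →+ R) (r : R) (n : ℕ) :
    skewCoeff σ δ n r n = σ^[n] r := by
  induction n with
  | zero => rfl
  | succ n ih =>
    rw [skewCoeff, ih, skewCoeff_eq_zero_of_lt _ _ _ (Nat.lt_succ_self n), map_zero, add_zero,
      Function.iterate_succ_apply']

theorem X_pow_add_dvd_skewCoeff (ε : ℤ_[p]) (hε : PadicInt.toZMod ε = 1) {k : ℕ}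
    {r : PowerSeries (ZMod p)} (hr : PowerSeries.X ^ k ∣ r) (n m : ℕ) :
    PowerSeries.X ^ (k + (n - m)) ∣ skewCoeff (sigmaHom p ε) (deltaHom p ε) n r m := by
  induction n generalizing m with
  | zero =>
    cases m with
    | zero => simpa [skewCoeff] using hr
    | succ m => simp [skewCoeff]
  | succ n ih =>
    cases m with
    | zero => exact X_pow_dvd_deltaHom p ε _ _ hε (by simpa using ih 0)
    | succ m =>
      rw [Nat.add_sub_add_right]
      refine dvd_add (X_pow_dvd_sigmaHom p ε _ _ hε (ih m)) ?_
      exact (pow_dvd_pow _ (by omega)).trans (X_pow_dvd_deltaHom p ε _ _ hε (ih (m + 1)))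

namespace SkewPowerSeries

variable {p} {ε : ℤ_[p]}

theorem coeff_add (f g : SkewFpSeries p ε) (n : ℕ) :
    (f + g).coeff n = f.coeff n + g.coeff n := rfl

theorem coeff_C (r : PowerSeries (ZMod p)) (n : ℕ) :
    (C (sigmaHom p ε) (deltaHom p ε) r).coeff n = if n = 0 then r else 0 := rfl

theorem coeff_mul (f g : SkewFpSeries p ε) (n : ℕ) :
    (f * g).coeff n = ∑ j ∈ Finset.range (n + 1),
      ∑' i : ℕ, f.coeff (n - j + i) *
        skewCoeff (sigmaHom p ε) (deltaHom p ε) (n - j + i) (g.coeff j) (n - j) := rfl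

/-- Modulo `X^N`, the inner sums in the product can be cut off at `N`. -/
theorem X_pow_dvd_coeff_mul_sub (hε : PadicInt.toZMod ε = 1) (f g : SkewFpSeries p ε) (n N : ℕ) :
    PowerSeries.X ^ N ∣ (f * g).coeff n - ∑ j ∈ Finset.range (n + 1), ∑ i ∈ Finset.range N,
      f.coeff (n - j + i) *
        skewCoeff (sigmaHom p ε) (deltaHom p ε) (n - j + i) (g.coeff j) (n - j) := by
  rw [coeff_mul, ← Finset.sum_sub_distrib]
  refine Finset.dvd_sum fun j _ => X_pow_dvd_tsum_sub_sum p _ (fun i => ?_) N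
  have h := X_pow_dvd_skewCoeff p ε hε (n - j + i) (g.coeff j) (n - j)
  rw [Nat.add_sub_cancel_left] at h
  exact h.mul_left _

theorem coeff_C_mul (r : PowerSeries (ZMod p)) (f : SkewFpSeries p ε) (n : ℕ) :
    (C (sigmaHom p ε) (deltaHom p ε) r * f).coeff n = r * f.coeff n := by
  rw [coeff_mul, Finset.sum_eq_single_of_mem n (by simp)]
  · rw [tsum_eq_single 0]
    · simp [coeff_C, skewCoeff]
    · intro i hi
      simp [coeff_C, hi]
  · intro j hj hjn
    have : n - j ≠ 0 := by have := Finset.mem_range.mp hj; omega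
    simp [coeff_C, this]

theorem coeff_mul_C (r : PowerSeries (ZMod p)) (f : SkewFpSeries p ε) (n : ℕ) :
    (f * C (sigmaHom p ε) (deltaHom p ε) r).coeff n =
      ∑' i : ℕ, f.coeff (n + i) * skewCoeff (sigmaHom p ε) (deltaHom p ε) (n + i) r n := by
  rw [coeff_mul, Finset.sum_eq_single_of_mem 0 (by simp)]
  · simp [coeff_C]
  · intro j _ hj
    simp [coeff_C, hj, skewCoeff_zero]

end SkewPowerSeries

end SkewCoeff

/-! ### Evaluation of power series at nilpotent elements -/

section NilEval

variable {k : Type*} [CommRing k]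

theorem Polynomial.aeval_eq_zero_of_coeff_eq_zero {B : Type*} [Ring B] [Algebra k B] {x : B}
    {N : ℕ} (hx : x ^ N = 0) {f : Polynomial k} (hf : ∀ d < N, f.coeff d = 0) :
    Polynomial.aeval x f = 0 := by
  obtain ⟨g, rfl⟩ := Polynomial.X_pow_dvd_iff.mpr hf
  rw [map_mul, map_pow, Polynomial.aeval_X, hx, zero_mul]

/-- The evaluation of power series at an element `x` with `x ^ N = 0`. -/
noncomputable def nilEval {B : Type*} [Ring B] [Algebra k B] (x : B) (N : ℕ) (hx : x ^ N = 0) :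
    PowerSeries k →+* B where
  toFun f := Polynomial.aeval x (PowerSeries.trunc N f)
  map_zero' := by simp
  map_add' f g := by simp
  map_one' := by
    rw [← sub_eq_zero, ← map_one (Polynomial.aeval (R := k) x), ← map_sub]
    apply Polynomial.aeval_eq_zero_of_coeff_eq_zero hx
    intro d hd
    simp [PowerSeries.coeff_trunc, hd, Polynomial.coeff_one, PowerSeries.coeff_one]
  map_mul' f g := by
    rw [← sub_eq_zero, ← map_mul (Polynomial.aeval (R := k) x), ← map_sub]
    apply Polynomial.aeval_eq_zero_of_coeff_eq_zero hx
    intro d hd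
    rw [Polynomial.coeff_sub, PowerSeries.coeff_trunc, if_pos hd,
      PowerSeries.coeff_mul_eq_coeff_trunc_mul_trunc f g hd, ← Polynomial.coe_mul,
      Polynomial.coeff_coe, sub_self]

variable {B : Type*} [Ring B] [Algebra k B] {x : B} {N : ℕ} (hx : x ^ N = 0)

theorem nilEval_eq_sum (f : PowerSeries k) :
    nilEval x N hx f = ∑ i ∈ Finset.range N, PowerSeries.coeff i f • x ^ i := by
  change Polynomial.aeval x (PowerSeries.trunc N f) = _
  rw [Polynomial.aeval_def, PowerSeries.eval₂_trunc_eq_sum_range]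
  simp [Algebra.smul_def]

theorem nilEval_coe (f : Polynomial k) :
    nilEval x N hx (f : PowerSeries k) = Polynomial.aeval x f := by
  change Polynomial.aeval x (PowerSeries.trunc N (f : PowerSeries k)) = _
  rw [← sub_eq_zero, ← map_sub]
  apply Polynomial.aeval_eq_zero_of_coeff_eq_zero hx
  intro d hd
  simp [PowerSeries.coeff_trunc, hd]

theorem nilEval_X : nilEval x N hx (PowerSeries.X : PowerSeries k) = x := by
  rw [← Polynomial.coe_X, nilEval_coe, Polynomial.aeval_X]

theorem nilEval_C (a : k) : nilEval x N hx (PowerSeries.C a) = algebraMap k B a := by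
  rw [← Polynomial.coe_C, nilEval_coe, Polynomial.aeval_C]

/-- A ring homomorphism from `k[[X]]` that maps `X` to a nilpotent element is determined by its
values at `X` and at the constants. -/
theorem PowerSeries.ringHom_ext_of_nilpotent {B : Type*} [Ring B]
    {f g : PowerSeries k →+* B} {N : ℕ} (hN : f PowerSeries.X ^ N = 0)
    (hX : f PowerSeries.X = g PowerSeries.X)
    (hC : ∀ a, f (PowerSeries.C a) = g (PowerSeries.C a)) : f = g := by
  have hpoly : f.comp Polynomial.coeToPowerSeries.ringHom =
      g.comp Polynomial.coeToPowerSeries.ringHom := by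
    apply Polynomial.ringHom_ext
    · intro a; simpa using hC a
    · simpa using hX
  ext h
  rw [PowerSeries.eq_X_pow_mul_shift_add_trunc N h, map_add, map_add, map_mul, map_mul, map_pow,
    map_pow, ← hX, hN, zero_mul, zero_mul]
  congr 1
  exact DFunLike.congr_fun hpoly (PowerSeries.trunc N h)

end NilEval

/-! ### Evaluation of skew power series at nilpotent elements -/

section SkewEval

variable {p : ℕ} [Fact p.Prime] {ε : ℤ_[p]} {B : Type*} [Ring B] [Algebra (ZMod p) B]
  {x y : B} {N : ℕ} (hx : x ^ N = 0)

/-- The value `∑ rₙ(x) yⁿ` of the skew power series `∑ rₙ Yⁿ`, where `x ^ N = 0`. It is meant for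
elements `y` with `y ^ N = 0`, for which the terms that are left out vanish. -/
noncomputable def skewEval (y : B) (hx : x ^ N = 0) (s : SkewFpSeries p ε) : B :=
  ∑ n ∈ Finset.range N, nilEval x N hx (s.coeff n) * y ^ n

theorem sum_range_eq_of_pow_eq_zero (hy : y ^ N = 0) (f : ℕ → B) {M : ℕ} (hM : N ≤ M) :
    ∑ n ∈ Finset.range M, f n * y ^ n = ∑ n ∈ Finset.range N, f n * y ^ n := by
  symm
  apply Finset.sum_subset (Finset.range_subset_range.mpr hM)
  intro n _ hn
  rw [pow_eq_zero_of_le (by simpa using hn) hy, mul_zero]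

theorem nilEval_eq_zero_of_X_pow_dvd {r : PowerSeries (ZMod p)} {M : ℕ} (hM : N ≤ M)
    (h : PowerSeries.X ^ M ∣ r) : nilEval x N hx r = 0 := by
  obtain ⟨g, rfl⟩ := h
  rw [map_mul, map_pow, nilEval_X, pow_eq_zero_of_le hM hx, zero_mul]

theorem skewEval_add (s t : SkewFpSeries p ε) :
    skewEval y hx (s + t) = skewEval y hx s + skewEval y hx t := by
  simp [skewEval, SkewPowerSeries.coeff_add, add_mul, Finset.sum_add_distrib]

theorem skewEval_C (hN : N ≠ 0) (r : PowerSeries (ZMod p)) :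
    skewEval y hx (SkewPowerSeries.C (sigmaHom p ε) (deltaHom p ε) r) = nilEval x N hx r := by
  rw [skewEval, Finset.sum_eq_single_of_mem 0 (by simpa using Nat.pos_of_ne_zero hN)]
  · simp [SkewPowerSeries.coeff_C]
  · intro n _ hn
    simp [SkewPowerSeries.coeff_C, hn]

theorem skewEval_Y (hy : y ^ N = 0) :
    skewEval y hx (SkewPowerSeries.Y (sigmaHom p ε) (deltaHom p ε)) = y := by
  rw [skewEval, ← sum_range_eq_of_pow_eq_zero hy _ (Nat.le_add_right N 2),
    Finset.sum_eq_single_of_mem 1 (by simp)]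
  · simp [SkewPowerSeries.Y]
  · intro n _ hn
    simp [SkewPowerSeries.Y, hn]

/-- Evaluation is natural in the ring, and independent of the exponent `N`. -/
theorem map_skewEval {B' : Type*} [Ring B'] [Algebra (ZMod p) B'] (φ : B →+* B')
    (hy : y ^ N = 0) {x' y' : B'} (hφx : φ x = x') (hφy : φ y = y') {N' : ℕ}
    (hx' : x' ^ N' = 0) (hy' : y' ^ N' = 0) (s : SkewFpSeries p ε) :
    φ (skewEval y hx s) = skewEval y' hx' s := by
  have hE : φ.comp (nilEval (k := ZMod p) x N hx) = nilEval x' N' hx' := by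
    apply PowerSeries.ringHom_ext_of_nilpotent (N := N')
    · simpa [nilEval_X, hφx] using hx'
    · simp [nilEval_X, hφx]
    · intro a
      simp only [RingHom.comp_apply, nilEval_C]
      exact DFunLike.congr_fun (RingHom.ext_zmod (φ.comp (algebraMap (ZMod p) B))
        (algebraMap (ZMod p) B')) a
  have hE' (r : PowerSeries (ZMod p)) : φ (nilEval x N hx r) = nilEval x' N' hx' r :=
    DFunLike.congr_fun hE r
  have hφN : y' ^ N = 0 := by rw [← hφy, ← map_pow, hy, map_zero]
  rw [skewEval, skewEval, map_sum]
  simp only [map_mul, map_pow, hE', hφy]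
  rw [← sum_range_eq_of_pow_eq_zero hφN _ (le_max_left N N'),
    ← sum_range_eq_of_pow_eq_zero hy' _ (le_max_right N N')]

theorem mul_nilEval (r : PowerSeries (ZMod p)) (hxy : ∀ r : PowerSeries (ZMod p),
    (1 + y) * nilEval x N hx r = nilEval x N hx (sigmaHom p ε r) * (1 + y)) :
    y * nilEval x N hx r = nilEval x N hx (sigmaHom p ε r) * y +
      nilEval x N hx (deltaHom p ε r) := by
  have h1 : deltaHom p ε r = sigmaHom p ε r - r := rfl
  have h := hxy r
  rw [h1, map_sub]
  rw [add_mul, one_mul, mul_add, mul_one] at h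
  rw [eq_sub_of_add_eq' h]
  abel

variable (hy : y ^ N = 0)
  (hxy : ∀ r : PowerSeries (ZMod p),
    (1 + y) * nilEval x N hx r = nilEval x N hx (sigmaHom p ε r) * (1 + y))

include hy hxy in
theorem pow_mul_nilEval (n : ℕ) (r : PowerSeries (ZMod p)) :
    y ^ n * nilEval x N hx r = ∑ m ∈ Finset.range N,
      nilEval x N hx (skewCoeff (sigmaHom p ε) (deltaHom p ε) n r m) * y ^ m := by
  have key (n : ℕ) (r : PowerSeries (ZMod p)) :
      y ^ n * nilEval x N hx r = ∑ m ∈ Finset.range (n + 1),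
        nilEval x N hx (skewCoeff (sigmaHom p ε) (deltaHom p ε) n r m) * y ^ m := by
    induction n with
    | zero => simp [skewCoeff]
    | succ n ih =>
      rw [pow_succ', mul_assoc, ih, Finset.mul_sum]
      conv_rhs => rw [Finset.sum_range_succ']
      simp only [skewCoeff, map_add, add_mul, Finset.sum_add_distrib, pow_zero, mul_one]
      have h2 := Finset.sum_range_succ' (fun m => nilEval x N hx (deltaHom p ε
        (skewCoeff (sigmaHom p ε) (deltaHom p ε) n r m)) * y ^ m) (n + 1)
      rw [Finset.sum_range_succ, skewCoeff_eq_zero_of_lt _ _ _ (Nat.lt_succ_self n)] at h2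
      simp only [map_zero, zero_mul, add_zero, pow_zero, mul_one] at h2
      rw [add_assoc, ← h2, ← Finset.sum_add_distrib]
      refine Finset.sum_congr rfl fun m _ => ?_
      rw [← mul_assoc, mul_nilEval hx _ hxy, add_mul, pow_succ', mul_assoc]
  rw [key, ← sum_range_eq_of_pow_eq_zero hy _ (le_max_left N (n + 1))]
  apply Finset.sum_subset (Finset.range_subset_range.mpr (le_max_right _ _))
  intro m _ hm
  rw [skewCoeff_eq_zero_of_lt _ _ _ (by simpa using hm), map_zero, zero_mul]

include hy hxy in
theorem skewEval_mul_nilEval (hε : PadicInt.toZMod ε = 1) (s : SkewFpSeries p ε)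
    (r : PowerSeries (ZMod p)) :
    skewEval y hx s * nilEval x N hx r = ∑ m ∈ Finset.range N, (∑ i ∈ Finset.range N,
      nilEval x N hx (s.coeff (m + i) *
        skewCoeff (sigmaHom p ε) (deltaHom p ε) (m + i) r m)) * y ^ m := by
  rw [skewEval, ← sum_range_eq_of_pow_eq_zero hy _ (Nat.le_add_right N N), Finset.sum_mul]
  simp only [mul_assoc, pow_mul_nilEval hx hy hxy, Finset.mul_sum]
  rw [Finset.sum_comm]
  refine Finset.sum_congr rfl fun m hm => ?_
  have hmN := Finset.mem_range.mp hm
  rw [Finset.sum_mul]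
  have h1 := Finset.sum_Ico_eq_sum_range (fun l => nilEval x N hx (s.coeff l *
    skewCoeff (sigmaHom p ε) (deltaHom p ε) l r m) * y ^ m) m (m + N)
  rw [Nat.add_sub_cancel_left] at h1
  rw [← h1]
  simp only [map_mul, mul_assoc]
  symm
  apply Finset.sum_subset
  · intro l hl
    have := Finset.mem_Ico.mp hl
    exact Finset.mem_range.mpr (by omega)
  · intro l _ hl
    rw [Finset.mem_Ico, not_and_or, not_le, not_lt] at hl
    rcases hl with hl | hl
    · rw [skewCoeff_eq_zero_of_lt _ _ _ hl, map_zero, zero_mul, mul_zero]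
    · rw [nilEval_eq_zero_of_X_pow_dvd hx (by omega) (X_pow_dvd_skewCoeff p ε hε l r m), zero_mul,
        mul_zero]

include hy hxy in
theorem skewEval_mul (hε : PadicInt.toZMod ε = 1) (s t : SkewFpSeries p ε) :
    skewEval y hx (s * t) = skewEval y hx s * skewEval y hx t := by
  let F : ℕ → ℕ → B := fun j m => (∑ i ∈ Finset.range N, nilEval x N hx (s.coeff (m + i) *
    skewCoeff (sigmaHom p ε) (deltaHom p ε) (m + i) (t.coeff j) m)) * y ^ (m + j)
  have h1 : skewEval y hx (s * t) =
      ∑ n ∈ Finset.range N, ∑ j ∈ Finset.range (n + 1), F j (n - j) := by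
    refine Finset.sum_congr rfl fun n _ => ?_
    have h2 := nilEval_eq_zero_of_X_pow_dvd hx le_rfl
      (SkewPowerSeries.X_pow_dvd_coeff_mul_sub hε s t n N)
    rw [map_sub, sub_eq_zero] at h2
    rw [h2, map_sum, Finset.sum_mul]
    refine Finset.sum_congr rfl fun j hj => ?_
    have := Finset.mem_range.mp hj
    simp only [F, map_sum, Nat.sub_add_cancel (Nat.lt_succ_iff.mp this)]
  have h3 : skewEval y hx s * skewEval y hx t =
      ∑ j ∈ Finset.range N, ∑ m ∈ Finset.range N, F j m := by
    conv_lhs => rw [skewEval.eq_1 y hx t, Finset.mul_sum]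
    refine Finset.sum_congr rfl fun j _ => ?_
    rw [← mul_assoc, skewEval_mul_nilEval hx hy hxy hε, Finset.sum_mul]
    refine Finset.sum_congr rfl fun m _ => ?_
    rw [mul_assoc, ← pow_add]
  rw [h1, h3, Finset.sum_range_diag_flip]
  refine Finset.sum_congr rfl fun j _ => ?_
  apply Finset.sum_subset (Finset.range_subset_range.mpr (Nat.sub_le _ _))
  intro m _ hm
  have := Finset.mem_range.not.mp hm
  simp only [F]
  rw [pow_eq_zero_of_le (by omega) hy, mul_zero]

end SkewEval

/-! ### Congruence subgroups of `ℤ_p ⋊ ℤ_p` -/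

section Congruence

variable {p : ℕ} [Fact p.Prime] {ρ : Multiplicative ℤ_[p] →ₜ* ℤ_[p]ˣ}

theorem toZMod_action (ρ : Multiplicative ℤ_[p] →ₜ* ℤ_[p]ˣ) (b : ℤ_[p]) :
    PadicInt.toZMod (ρ (Multiplicative.ofAdd b) : ℤ_[p]) = 1 := by
  let μ : Multiplicative ℤ_[p] →ₜ* Multiplicative ℤ_[p] :=
    { toMonoidHom := AddMonoidHom.toMultiplicative (AddMonoidHom.mulLeft b)
      continuous_toFun := continuous_ofAdd.comp
        ((continuous_const.mul continuous_id).comp continuous_toAdd) }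
  have h := toZMod_padicAction_one p (ρ.comp μ)
  have h1 : (ρ.comp μ) (Multiplicative.ofAdd 1) = ρ (Multiplicative.ofAdd b) := by
    change ρ (Multiplicative.ofAdd (b * 1)) = _
    rw [mul_one]
  rwa [h1] at h

theorem pow_dvd_action_sub_one (ρ : Multiplicative ℤ_[p] →ₜ* ℤ_[p]ˣ) {b : ℤ_[p]} {m : ℕ}
    (hb : (p : ℤ_[p]) ^ m ∣ b) :
    (p : ℤ_[p]) ^ m ∣ (ρ (Multiplicative.ofAdd b) : ℤ_[p]) - 1 := by
  obtain ⟨t, rfl⟩ := hb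
  have h : Multiplicative.ofAdd ((p : ℤ_[p]) ^ m * t) = Multiplicative.ofAdd t ^ p ^ m := by
    rw [← ofAdd_nsmul, nsmul_eq_mul, Nat.cast_pow]
  rw [h, map_pow, Units.val_pow_eq_pow_val]
  exact (pow_dvd_pow _ (Nat.le_succ m)).trans (pow_dvd_pow_sub_one (toZMod_action ρ t) m)

variable {G : Type*} [Group G] [TopologicalSpace G] (e : G ≃ₜ* PadicSemidirect p ρ)

/-- The first coordinate of an element of `G ≅ ℤ_p ⋊ ℤ_p`. -/
noncomputable def leftCoord (g : G) : ℤ_[p] := (e g).left.toAdd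

/-- The second coordinate of an element of `G ≅ ℤ_p ⋊ ℤ_p`. -/
noncomputable def rightCoord (g : G) : ℤ_[p] := (e g).right.toAdd

theorem leftCoord_mul (g h : G) : leftCoord e (g * h) =
    leftCoord e g + (ρ (Multiplicative.ofAdd (rightCoord e g)) : ℤ_[p]) * leftCoord e h := by
  rw [leftCoord, map_mul, SemidirectProduct.mul_left]
  rfl

theorem rightCoord_mul (g h : G) : rightCoord e (g * h) = rightCoord e g + rightCoord e h := by
  rw [rightCoord, map_mul, SemidirectProduct.mul_right]
  rfl

theorem leftCoord_one : leftCoord e 1 = 0 := by rw [leftCoord, map_one]; rfl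

theorem rightCoord_one : rightCoord e 1 = 0 := by rw [rightCoord, map_one]; rfl

theorem rightCoord_inv (g : G) : rightCoord e g⁻¹ = -rightCoord e g := by
  rw [rightCoord, map_inv]; rfl

theorem leftCoord_inv (g : G) : leftCoord e g⁻¹ =
    -((ρ (Multiplicative.ofAdd (-rightCoord e g)) : ℤ_[p]) * leftCoord e g) := by
  have h := leftCoord_mul e g⁻¹ g
  rw [inv_mul_cancel, leftCoord_one, rightCoord_inv] at h
  exact eq_neg_of_add_eq_zero_left h.symm

theorem continuous_leftCoord : Continuous (leftCoord e) :=
  continuous_toAdd.comp ((continuous_fst.comp continuous_induced_dom).comp e.continuous)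

theorem continuous_rightCoord : Continuous (rightCoord e) :=
  continuous_toAdd.comp ((continuous_snd.comp continuous_induced_dom).comp e.continuous)

theorem isOpen_setOf_pow_dvd (m : ℕ) : IsOpen {z : ℤ_[p] | (p : ℤ_[p]) ^ m ∣ z} := by
  have h : {z : ℤ_[p] | (p : ℤ_[p]) ^ m ∣ z} = Metric.closedBall 0 ((p : ℝ) ^ (-(m : ℤ))) := by
    ext z
    rw [Set.mem_ofPred_eq, mem_closedBall_zero_iff, PadicInt.norm_le_pow_iff_mem_span_pow,
      Ideal.mem_span_singleton]
  rw [h]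
  apply IsUltrametricDist.isOpen_closedBall
  have : (p : ℝ) ≠ 0 := by exact_mod_cast (Fact.out : p.Prime).ne_zero
  positivity

/-- The open normal subgroup of the elements of `G ≅ ℤ_p ⋊ ℤ_p` both of whose coordinates are
divisible by `p^m`. -/
noncomputable def congruenceSubgroup (m : ℕ) : OpenNormalSubgroup G where
  carrier := {g | (p : ℤ_[p]) ^ m ∣ leftCoord e g ∧ (p : ℤ_[p]) ^ m ∣ rightCoord e g}
  mul_mem' := by
    rintro g h ⟨hg1, hg2⟩ ⟨hh1, hh2⟩
    exact ⟨by rw [leftCoord_mul]; exact dvd_add hg1 (hh1.mul_left _),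
      by rw [rightCoord_mul]; exact dvd_add hg2 hh2⟩
  one_mem' := by
    constructor
    · rw [leftCoord_one]; exact dvd_zero _
    · rw [rightCoord_one]; exact dvd_zero _
  inv_mem' := by
    rintro g ⟨h1, h2⟩
    exact ⟨by rw [leftCoord_inv]; exact (dvd_neg.mpr (h1.mul_left _)),
      by rw [rightCoord_inv]; exact dvd_neg.mpr h2⟩
  isOpen' := ((isOpen_setOf_pow_dvd m).preimage (continuous_leftCoord e)).inter
    ((isOpen_setOf_pow_dvd m).preimage (continuous_rightCoord e))
  isNormal' := by
    refine ⟨?_⟩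
    rintro h ⟨h1, h2⟩ g
    constructor
    · -- the first coordinate of `g h g⁻¹` is `(1 - ρ(d)) a + ρ(b) c`
      have key : leftCoord e (g * h * g⁻¹) =
          (ρ (Multiplicative.ofAdd (rightCoord e g)) : ℤ_[p]) * leftCoord e h -
          ((ρ (Multiplicative.ofAdd (rightCoord e h)) : ℤ_[p]) - 1) * leftCoord e g := by
        rw [leftCoord_mul, leftCoord_mul, leftCoord_inv, rightCoord_mul, mul_neg, ← mul_assoc,
          ← Units.val_mul, ← map_mul, ← ofAdd_add, add_neg_cancel_comm]
        ring
      rw [key]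
      exact dvd_sub (h1.mul_left _) ((pow_dvd_action_sub_one ρ h2).mul_right _)
    · rw [rightCoord_mul, rightCoord_mul, rightCoord_inv, add_neg_cancel_comm]
      exact h2

theorem mem_congruenceSubgroup {m : ℕ} {g : G} : g ∈ (congruenceSubgroup e m).toSubgroup ↔
    (p : ℤ_[p]) ^ m ∣ leftCoord e g ∧ (p : ℤ_[p]) ^ m ∣ rightCoord e g := Iff.rfl

theorem congruenceSubgroup_anti {m n : ℕ} (h : m ≤ n) :
    (congruenceSubgroup e n).toSubgroup ≤ (congruenceSubgroup e m).toSubgroup :=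
  fun _ hg => ⟨(pow_dvd_pow _ h).trans hg.1, (pow_dvd_pow _ h).trans hg.2⟩

theorem exists_congruenceSubgroup_le (V : OpenNormalSubgroup G) :
    ∃ m, (congruenceSubgroup e m).toSubgroup ≤ V.toSubgroup := by
  let ψ : ℤ_[p] × ℤ_[p] → G := fun z => e.symm ⟨Multiplicative.ofAdd z.1, Multiplicative.ofAdd z.2⟩
  have hψ : Continuous ψ := by
    refine e.symm.continuous.comp (continuous_induced_rng.mpr ?_)
    exact (continuous_ofAdd.comp continuous_fst).prodMk (continuous_ofAdd.comp continuous_snd)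
  have hψg (g : G) : ψ (leftCoord e g, rightCoord e g) = g := e.symm_apply_apply g
  have hV : IsOpen (ψ ⁻¹' (V : Set G)) := V.isOpen'.preimage hψ
  have h0 : ((0, 0) : ℤ_[p] × ℤ_[p]) ∈ ψ ⁻¹' (V : Set G) := by
    have := hψg 1
    rw [leftCoord_one, rightCoord_one] at this
    change ψ (0, 0) ∈ V.toSubgroup
    rw [this]
    exact one_mem _
  obtain ⟨r, hr, hball⟩ := Metric.isOpen_iff.mp hV _ h0
  obtain ⟨m, hm⟩ := PadicInt.exists_pow_neg_lt p hr
  refine ⟨m, fun g hg => ?_⟩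
  have hlt {z : ℤ_[p]} (hz : (p : ℤ_[p]) ^ m ∣ z) : dist z 0 < r := by
    rw [dist_zero_right]
    refine lt_of_le_of_lt ?_ hm
    rw [PadicInt.norm_le_pow_iff_mem_span_pow, Ideal.mem_span_singleton]
    exact hz
  have : (leftCoord e g, rightCoord e g) ∈ ψ ⁻¹' (V : Set G) :=
    hball (by rw [Metric.mem_ball, Prod.dist_eq]; exact max_lt (hlt hg.1) (hlt hg.2))
  rw [Set.mem_preimage, hψg] at this
  exact this

theorem toZModPow_eq_zero_iff (m : ℕ) (z : ℤ_[p]) :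
    PadicInt.toZModPow m z = 0 ↔ (p : ℤ_[p]) ^ m ∣ z := by
  rw [← RingHom.mem_ker, PadicInt.ker_toZModPow, Ideal.mem_span_singleton]

theorem inv_mul_mem_congruenceSubgroup_iff {m : ℕ} {g h : G} :
    g⁻¹ * h ∈ (congruenceSubgroup e m).toSubgroup ↔
      (p : ℤ_[p]) ^ m ∣ leftCoord e h - leftCoord e g ∧
      (p : ℤ_[p]) ^ m ∣ rightCoord e h - rightCoord e g := by
  rw [mem_congruenceSubgroup, leftCoord_mul, rightCoord_mul, leftCoord_inv, rightCoord_inv,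
    neg_add_eq_sub, neg_add_eq_sub, ← mul_sub]
  rw [(Units.isUnit _).dvd_mul_left]

theorem card_quotient_congruenceSubgroup (m : ℕ) :
    Nat.card (G ⧸ (congruenceSubgroup e m).toSubgroup) = p ^ m * p ^ m := by
  let F : G ⧸ (congruenceSubgroup e m).toSubgroup → ZMod (p ^ m) × ZMod (p ^ m) :=
    Quotient.lift (fun g => (PadicInt.toZModPow m (leftCoord e g),
      PadicInt.toZModPow m (rightCoord e g))) (by
        intro a b hab
        have h := (inv_mul_mem_congruenceSubgroup_iff e).mp (QuotientGroup.leftRel_apply.mp hab)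
        rw [← toZModPow_eq_zero_iff, ← toZModPow_eq_zero_iff, map_sub, map_sub, sub_eq_zero,
          sub_eq_zero] at h
        rw [Prod.mk.injEq]
        exact ⟨h.1.symm, h.2.symm⟩)
  have hF : Function.Bijective F := by
    constructor
    · rintro ⟨a⟩ ⟨b⟩ hab
      have hab' := Prod.mk.injEq _ _ _ _ ▸ hab
      apply QuotientGroup.eq.mpr
      rw [inv_mul_mem_congruenceSubgroup_iff, ← toZModPow_eq_zero_iff, ← toZModPow_eq_zero_iff,
        map_sub, map_sub, sub_eq_zero, sub_eq_zero]
      exact ⟨hab'.1.symm, hab'.2.symm⟩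
    · rintro ⟨a, b⟩
      obtain ⟨a, rfl⟩ := ZMod.ringHom_surjective (PadicInt.toZModPow (p := p) m) a
      obtain ⟨b, rfl⟩ := ZMod.ringHom_surjective (PadicInt.toZModPow (p := p) m) b
      refine ⟨QuotientGroup.mk (e.symm ⟨Multiplicative.ofAdd a, Multiplicative.ofAdd b⟩), ?_⟩
      change (PadicInt.toZModPow m (leftCoord e _), PadicInt.toZModPow m (rightCoord e _)) = _
      rw [leftCoord, rightCoord, ContinuousMulEquiv.apply_symm_apply]
      rfl
  rw [Nat.card_congr (Equiv.ofBijective F hF), Nat.card_prod, Nat.card_zmod]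

end Congruence

/-! ### Skew power series in the group algebras of the finite quotients -/

section Level

variable {p : ℕ} [Fact p.Prime] {ρ : Multiplicative ℤ_[p] →ₜ* ℤ_[p]ˣ}
  {G : Type*} [Group G] [TopologicalSpace G] (e : G ≃ₜ* PadicSemidirect p ρ)

/-- The canonical map from `G` to `𝔽_p[G/V]`. -/
noncomputable def toLevel (p : ℕ) {G : Type*} [Group G] [TopologicalSpace G]
    (V : OpenNormalSubgroup G) : G →* MonoidAlgebra (ZMod p) (G ⧸ V.toSubgroup) :=
  (MonoidAlgebra.of (ZMod p) (G ⧸ V.toSubgroup)).comp (QuotientGroup.mk' V.toSubgroup)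

omit [Fact p.Prime] in
theorem toLevel_eq_of_inv_mul_mem (V : OpenNormalSubgroup G) {g h : G}
    (hgh : g⁻¹ * h ∈ V.toSubgroup) : toLevel p V g = toLevel p V h := by
  have : (QuotientGroup.mk g : G ⧸ V.toSubgroup) = QuotientGroup.mk h := QuotientGroup.eq.mpr hgh
  change MonoidAlgebra.of _ _ (QuotientGroup.mk g : G ⧸ V.toSubgroup) =
    MonoidAlgebra.of _ _ (QuotientGroup.mk h : G ⧸ V.toSubgroup)
  rw [this]

theorem toLevel_sub_one_pow (V : OpenNormalSubgroup G) {g : G} {m : ℕ}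
    (hg : g ^ p ^ m ∈ V.toSubgroup) : (toLevel p V g - 1) ^ p ^ m = 0 := by
  have : CharP (MonoidAlgebra (ZMod p) (G ⧸ V.toSubgroup)) p :=
    charP_of_injective_algebraMap (FaithfulSMul.algebraMap_injective (ZMod p) _) p
  rw [sub_pow_char_pow_of_commute _ _ (Commute.one_right _), one_pow, ← map_pow,
    toLevel_eq_of_inv_mul_mem V (h := 1) (by simpa using hg), map_one, sub_self]

theorem leftCoord_of_eq_inl {g : G} {z : ℤ_[p]}
    (hg : e g = SemidirectProduct.inl (Multiplicative.ofAdd z)) : leftCoord e g = z := by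
  rw [leftCoord, hg]; rfl

theorem rightCoord_of_eq_inl {g : G} {z : ℤ_[p]}
    (hg : e g = SemidirectProduct.inl (Multiplicative.ofAdd z)) : rightCoord e g = 0 := by
  rw [rightCoord, hg]; rfl

theorem leftCoord_of_eq_inr {g : G} {z : ℤ_[p]}
    (hg : e g = SemidirectProduct.inr (Multiplicative.ofAdd z)) : leftCoord e g = 0 := by
  rw [leftCoord, hg]; rfl

theorem rightCoord_of_eq_inr {g : G} {z : ℤ_[p]}
    (hg : e g = SemidirectProduct.inr (Multiplicative.ofAdd z)) : rightCoord e g = z := by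
  rw [rightCoord, hg]; rfl

theorem pow_eq_inl {γ₁ : G} (hγ₁ : e γ₁ = SemidirectProduct.inl (Multiplicative.ofAdd 1)) (n : ℕ) :
    e (γ₁ ^ n) = SemidirectProduct.inl (Multiplicative.ofAdd (n : ℤ_[p])) := by
  rw [map_pow, hγ₁, ← map_pow, ← ofAdd_nsmul, nsmul_eq_mul, mul_one]

theorem pow_eq_inr {γ₂ : G} (hγ₂ : e γ₂ = SemidirectProduct.inr (Multiplicative.ofAdd 1)) (n : ℕ) :
    e (γ₂ ^ n) = SemidirectProduct.inr (Multiplicative.ofAdd (n : ℤ_[p])) := by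
  rw [map_pow, hγ₂, ← map_pow, ← ofAdd_nsmul, nsmul_eq_mul, mul_one]

variable {γ₁ γ₂ : G} (hγ₁ : e γ₁ = SemidirectProduct.inl (Multiplicative.ofAdd 1))
  (hγ₂ : e γ₂ = SemidirectProduct.inr (Multiplicative.ofAdd 1))

include hγ₁ in
theorem toLevel_sub_one_pow_left {V : OpenNormalSubgroup G} {m : ℕ}
    (hV : (congruenceSubgroup e m).toSubgroup ≤ V.toSubgroup) :
    (toLevel p V γ₁ - 1) ^ p ^ m = 0 := by
  refine toLevel_sub_one_pow V (hV ((mem_congruenceSubgroup e).mpr ?_))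
  rw [leftCoord_of_eq_inl e (pow_eq_inl e hγ₁ _), rightCoord_of_eq_inl e (pow_eq_inl e hγ₁ _),
    Nat.cast_pow]
  exact ⟨dvd_rfl, dvd_zero _⟩

include hγ₂ in
theorem toLevel_sub_one_pow_right {V : OpenNormalSubgroup G} {m : ℕ}
    (hV : (congruenceSubgroup e m).toSubgroup ≤ V.toSubgroup) :
    (toLevel p V γ₂ - 1) ^ p ^ m = 0 := by
  refine toLevel_sub_one_pow V (hV ((mem_congruenceSubgroup e).mpr ?_))
  rw [leftCoord_of_eq_inr e (pow_eq_inr e hγ₂ _), rightCoord_of_eq_inr e (pow_eq_inr e hγ₂ _),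
    Nat.cast_pow]
  exact ⟨dvd_zero _, dvd_rfl⟩

include hγ₁ in
/-- The series `(1 + X)^z` takes the value `γ₁^z` at `X = γ₁ - 1`. -/
theorem nilEval_onePlusXPow {V : OpenNormalSubgroup G} {m : ℕ}
    (hV : (congruenceSubgroup e m).toSubgroup ≤ V.toSubgroup)
    (hx : (toLevel p V γ₁ - 1) ^ p ^ m = 0) {g : G} {z : ℤ_[p]}
    (hg : e g = SemidirectProduct.inl (Multiplicative.ofAdd z)) :
    nilEval (toLevel p V γ₁ - 1) (p ^ m) hx (onePlusXPow p z) = toLevel p V g := by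
  have h1 := nilEval_eq_zero_of_X_pow_dvd hx le_rfl
    (X_pow_dvd_onePlusXPow_sub p m _ _ (sub_appr_dvd p z m))
  rw [map_sub, sub_eq_zero] at h1
  rw [h1, onePlusXPow_natCast, map_pow, map_add, map_one, nilEval_X, add_sub_cancel, ← map_pow]
  apply toLevel_eq_of_inv_mul_mem
  apply hV
  rw [inv_mul_mem_congruenceSubgroup_iff, leftCoord_of_eq_inl e hg, rightCoord_of_eq_inl e hg,
    leftCoord_of_eq_inl e (pow_eq_inl e hγ₁ _), rightCoord_of_eq_inl e (pow_eq_inl e hγ₁ _),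
    sub_zero]
  exact ⟨sub_appr_dvd p z m, dvd_zero _⟩

include hγ₁ hγ₂ in
/-- The relation `γ₂ r = σ(r) γ₂` for power series `r` in `γ₁ - 1`. It holds since both
`r ↦ γ₂ r γ₂⁻¹` and `r ↦ σ(r)` are ring homomorphisms that map `γ₁ - 1` to `γ₁^ε - 1`. -/
theorem toLevel_mul_nilEval {ε : ℤ_[p]} (hε : ε = ρ (Multiplicative.ofAdd 1))
    {V : OpenNormalSubgroup G} {m : ℕ}
    (hV : (congruenceSubgroup e m).toSubgroup ≤ V.toSubgroup)
    (hx : (toLevel p V γ₁ - 1) ^ p ^ m = 0) (r : PowerSeries (ZMod p)) :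
    (1 + (toLevel p V γ₂ - 1)) * nilEval (toLevel p V γ₁ - 1) (p ^ m) hx r =
      nilEval (toLevel p V γ₁ - 1) (p ^ m) hx (sigmaHom p ε r) * (1 + (toLevel p V γ₂ - 1)) := by
  let u : (MonoidAlgebra (ZMod p) (G ⧸ V.toSubgroup))ˣ :=
    Units.map (toLevel p V) (toUnits γ₂)
  have hu : (u : MonoidAlgebra (ZMod p) (G ⧸ V.toSubgroup)) = toLevel p V γ₂ := rfl
  have hu' : ((u⁻¹ : (MonoidAlgebra (ZMod p) (G ⧸ V.toSubgroup))ˣ) :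
    MonoidAlgebra (ZMod p) (G ⧸ V.toSubgroup)) = toLevel p V γ₂⁻¹ := rfl
  let c := MulSemiringAction.toRingHom (ConjAct (MonoidAlgebra (ZMod p) (G ⧸ V.toSubgroup))ˣ)
    (MonoidAlgebra (ZMod p) (G ⧸ V.toSubgroup)) (ConjAct.toConjAct u)
  have hc (b : MonoidAlgebra (ZMod p) (G ⧸ V.toSubgroup)) :
    c b = u * b * (u⁻¹ : (MonoidAlgebra (ZMod p) (G ⧸ V.toSubgroup))ˣ) := rfl
  have h : c.comp (nilEval (toLevel p V γ₁ - 1) (p ^ m) hx) =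
      (nilEval (toLevel p V γ₁ - 1) (p ^ m) hx).comp (sigmaHom p ε) := by
    apply PowerSeries.ringHom_ext_of_nilpotent (N := p ^ m)
    · rw [RingHom.comp_apply, nilEval_X, ← map_pow, hx, map_zero]
    · rw [RingHom.comp_apply, nilEval_X, RingHom.comp_apply, sigmaHom_X,
        powSubOne_eq_onePlusXPow_sub_one, map_sub, map_one, map_sub, map_one,
        nilEval_onePlusXPow e hγ₁ hV hx (g := γ₂ * γ₁ * γ₂⁻¹), hc, hu, hu',
        map_mul, map_mul]
      rw [map_mul, map_mul, hγ₁, hγ₂, map_inv, hγ₂, ← map_inv, ← SemidirectProduct.inl_aut, hε]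
      congr 1
      change Multiplicative.ofAdd ((ρ (Multiplicative.ofAdd 1) : ℤ_[p]) * 1) = _
      rw [mul_one]
    · intro a
      simp only [RingHom.comp_apply, sigmaHom_C, nilEval_C]
      rw [hc, Algebra.commutes a (u : MonoidAlgebra (ZMod p) (G ⧸ V.toSubgroup)) |>.symm,
        mul_assoc, Units.mul_inv, mul_one]
  have h1 := DFunLike.congr_fun h r
  rw [RingHom.comp_apply, RingHom.comp_apply, hc] at h1
  rw [add_sub_cancel, ← h1, hu, mul_assoc _ _ (toLevel p V γ₂), ← hu, Units.inv_mul, mul_one]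

theorem toLevel_eq_pow_mul_pow {V : OpenNormalSubgroup G} {m : ℕ}
    (hγ₁ : e γ₁ = SemidirectProduct.inl (Multiplicative.ofAdd 1))
    (hγ₂ : e γ₂ = SemidirectProduct.inr (Multiplicative.ofAdd 1))
    (hV : (congruenceSubgroup e m).toSubgroup ≤ V.toSubgroup) (g : G) :
    ∃ a b : ℕ, toLevel p V g = toLevel p V γ₁ ^ a * toLevel p V γ₂ ^ b := by
  refine ⟨(leftCoord e g).appr m, (rightCoord e g).appr m, ?_⟩
  rw [← map_pow, ← map_pow, ← map_mul]
  symm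
  apply toLevel_eq_of_inv_mul_mem
  apply hV
  rw [inv_mul_mem_congruenceSubgroup_iff, leftCoord_mul, rightCoord_mul,
    leftCoord_of_eq_inl e (pow_eq_inl e hγ₁ _), rightCoord_of_eq_inl e (pow_eq_inl e hγ₁ _),
    leftCoord_of_eq_inr e (pow_eq_inr e hγ₂ _), rightCoord_of_eq_inr e (pow_eq_inr e hγ₂ _),
    mul_zero, add_zero, zero_add]
  exact ⟨sub_appr_dvd p _ m, sub_appr_dvd p _ m⟩

theorem skewEval_eq_sum {B : Type*} [Ring B] [Algebra (ZMod p) B] {ε : ℤ_[p]} {x y : B} {N : ℕ}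
    (hx : x ^ N = 0) (s : SkewFpSeries p ε) :
    skewEval y hx s = ∑ i : Fin N × Fin N,
      PowerSeries.coeff (i.1 : ℕ) (s.coeff i.2) • (x ^ (i.1 : ℕ) * y ^ (i.2 : ℕ)) := by
  rw [skewEval, Fintype.sum_prod_type_right, Finset.sum_range]
  refine Finset.sum_congr rfl fun l _ => ?_
  rw [nilEval_eq_sum, Finset.sum_mul, Finset.sum_range]
  simp only [smul_mul_assoc]

/-- The monomials `(γ₁ - 1)^k (γ₂ - 1)^l` with `k, l < p^m` span `𝔽_p[G/V]` if `V` contains the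
`m`-th congruence subgroup. -/
theorem span_monomials_eq_top {V : OpenNormalSubgroup G} {m : ℕ}
    (hγ₁ : e γ₁ = SemidirectProduct.inl (Multiplicative.ofAdd 1))
    (hγ₂ : e γ₂ = SemidirectProduct.inr (Multiplicative.ofAdd 1))
    (hV : (congruenceSubgroup e m).toSubgroup ≤ V.toSubgroup) :
    Submodule.span (ZMod p) (Set.range fun i : Fin (p ^ m) × Fin (p ^ m) =>
      (toLevel p V γ₁ - 1) ^ (i.1 : ℕ) * (toLevel p V γ₂ - 1) ^ (i.2 : ℕ)) = ⊤ := by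
  set W := Submodule.span (ZMod p) (Set.range fun i : Fin (p ^ m) × Fin (p ^ m) =>
      (toLevel p V γ₁ - 1) ^ (i.1 : ℕ) * (toLevel p V γ₂ - 1) ^ (i.2 : ℕ)) with hW
  have hmono (k l : ℕ) : (toLevel p V γ₁ - 1) ^ k * (toLevel p V γ₂ - 1) ^ l ∈ W := by
    by_cases hk : k < p ^ m
    · by_cases hl : l < p ^ m
      · exact Submodule.subset_span ⟨(⟨k, hk⟩, ⟨l, hl⟩), rfl⟩
      · rw [pow_eq_zero_of_le (not_lt.mp hl) (toLevel_sub_one_pow_right e hγ₂ hV), mul_zero]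
        exact W.zero_mem
    · rw [pow_eq_zero_of_le (not_lt.mp hk) (toLevel_sub_one_pow_left e hγ₁ hV), zero_mul]
      exact W.zero_mem
  have hpow (a b : ℕ) : toLevel p V γ₁ ^ a * toLevel p V γ₂ ^ b ∈ W := by
    rw [← sub_add_cancel (toLevel p V γ₁) 1, ← sub_add_cancel (toLevel p V γ₂) 1,
      (Commute.one_right (toLevel p V γ₁ - 1)).add_pow,
      (Commute.one_right (toLevel p V γ₂ - 1)).add_pow, Finset.sum_mul_sum]
    refine W.sum_mem fun k _ => W.sum_mem fun l _ => ?_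
    have : (toLevel p V γ₁ - 1) ^ k * 1 ^ (a - k) * (a.choose k : MonoidAlgebra (ZMod p) _) *
        ((toLevel p V γ₂ - 1) ^ l * 1 ^ (b - l) * (b.choose l : MonoidAlgebra (ZMod p) _)) =
        (a.choose k * b.choose l) • ((toLevel p V γ₁ - 1) ^ k * (toLevel p V γ₂ - 1) ^ l) := by
      rw [one_pow, one_pow, mul_one, mul_one, ← nsmul_eq_mul', ← nsmul_eq_mul', smul_mul_smul_comm]
    rw [this]
    exact W.nsmul_mem (hmono k l) _
  rw [eq_top_iff]
  rintro b -
  induction b using MonoidAlgebra.induction_linear with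
  | zero => exact W.zero_mem
  | add f g hf hg => exact W.add_mem hf hg
  | single q a =>
    obtain ⟨g, rfl⟩ := QuotientGroup.mk_surjective q
    obtain ⟨k, l, hkl⟩ := toLevel_eq_pow_mul_pow e hγ₁ hγ₂ hV g
    have h : MonoidAlgebra.single (QuotientGroup.mk g : G ⧸ V.toSubgroup) a =
        a • toLevel p V g := by
      simp [toLevel]
    rw [h, hkl]
    exact W.smul_mem _ (hpow k l)

/-- The monomials `(γ₁ - 1)^k (γ₂ - 1)^l` with `k, l < p^m` are linearly independent in the group
algebra of `G` modulo the `m`-th congruence subgroup: they span it, and there are as many of them as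
its dimension. -/
theorem linearIndependent_monomials (m : ℕ)
    (hγ₁ : e γ₁ = SemidirectProduct.inl (Multiplicative.ofAdd 1))
    (hγ₂ : e γ₂ = SemidirectProduct.inr (Multiplicative.ofAdd 1)) :
    LinearIndependent (ZMod p) (fun i : Fin (p ^ m) × Fin (p ^ m) =>
      (toLevel p (congruenceSubgroup e m) γ₁ - 1) ^ (i.1 : ℕ) *
        (toLevel p (congruenceSubgroup e m) γ₂ - 1) ^ (i.2 : ℕ)) := by
  apply linearIndependent_of_top_le_span_of_card_eq_finrank
  · rw [span_monomials_eq_top e hγ₁ hγ₂ le_rfl]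
  · rw [Module.finrank_eq_nat_card_basis (MonoidAlgebra.basis _ (ZMod p)),
      card_quotient_congruenceSubgroup]
    simp

end Level

/-! ### The isomorphism with the skew power series ring -/

section Iso

variable {p : ℕ} [Fact p.Prime] {ρ : Multiplicative ℤ_[p] →ₜ* ℤ_[p]ˣ}
  {G : Type*} [Group G] [TopologicalSpace G] (e : G ≃ₜ* PadicSemidirect p ρ)
  {γ₁ γ₂ : G} (hγ₁ : e γ₁ = SemidirectProduct.inl (Multiplicative.ofAdd 1))
  (hγ₂ : e γ₂ = SemidirectProduct.inr (Multiplicative.ofAdd 1)) {ε : ℤ_[p]}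

/-- The value of a skew power series in `𝔽_p[G/V]` at `γ₁ - 1` and `γ₂ - 1`, where `V` contains the
`m`-th congruence subgroup. -/
noncomputable def levelEval (γ₂ : G) {V : OpenNormalSubgroup G} {m : ℕ}
    (hγ₁ : e γ₁ = SemidirectProduct.inl (Multiplicative.ofAdd 1))
    (hV : (congruenceSubgroup e m).toSubgroup ≤ V.toSubgroup) (s : SkewFpSeries p ε) :
    MonoidAlgebra (ZMod p) (G ⧸ V.toSubgroup) :=
  skewEval (toLevel p V γ₂ - 1) (toLevel_sub_one_pow_left e hγ₁ hV) s

include hγ₂ in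
theorem map_levelEval {U V : OpenNormalSubgroup G} {m n : ℕ}
    (hU : (congruenceSubgroup e m).toSubgroup ≤ U.toSubgroup)
    (hV : (congruenceSubgroup e n).toSubgroup ≤ V.toSubgroup)
    (h : U.toSubgroup ≤ V.toSubgroup) (s : SkewFpSeries p ε) :
    MonoidAlgebra.mapDomainRingHom (ZMod p)
      (QuotientGroup.map U.toSubgroup V.toSubgroup (MonoidHom.id G) h)
      (levelEval e γ₂ hγ₁ hU s) = levelEval e γ₂ hγ₁ hV s := by
  have hmap (g : G) : MonoidAlgebra.mapDomainRingHom (ZMod p)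
      (QuotientGroup.map U.toSubgroup V.toSubgroup (MonoidHom.id G) h) (toLevel p U g) =
      toLevel p V g := (CompletedGroupAlgebra.of (ZMod p) g).2 U V h
  exact map_skewEval _ _ (toLevel_sub_one_pow_right e hγ₂ hU)
    (by rw [map_sub, map_one, hmap]) (by rw [map_sub, map_one, hmap]) _
    (toLevel_sub_one_pow_right e hγ₂ hV) s

include hγ₂ in
theorem coeff_eq_of_levelEval_eq {m : ℕ} {s t : SkewFpSeries p ε}
    (h : levelEval e γ₂ hγ₁ (le_refl (congruenceSubgroup e m).toSubgroup) s =
      levelEval e γ₂ hγ₁ le_rfl t) {k l : ℕ} (hk : k < p ^ m) (hl : l < p ^ m) :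
    PowerSeries.coeff k (s.coeff l) = PowerSeries.coeff k (t.coeff l) := by
  rw [levelEval, levelEval, skewEval_eq_sum, skewEval_eq_sum, ← sub_eq_zero,
    ← Finset.sum_sub_distrib] at h
  simp only [← sub_smul] at h
  exact sub_eq_zero.mp (Fintype.linearIndependent_iff.mp
    (linearIndependent_monomials e m hγ₁ hγ₂) _ h (⟨k, hk⟩, ⟨l, hl⟩))

theorem levelEval_congr {V : OpenNormalSubgroup G} {m : ℕ}
    (hV : (congruenceSubgroup e m).toSubgroup ≤ V.toSubgroup) {s t : SkewFpSeries p ε}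
    (h : ∀ k l, k < p ^ m → l < p ^ m →
      PowerSeries.coeff k (s.coeff l) = PowerSeries.coeff k (t.coeff l)) :
    levelEval e γ₂ hγ₁ hV s = levelEval e γ₂ hγ₁ hV t := by
  rw [levelEval, levelEval, skewEval_eq_sum, skewEval_eq_sum]
  refine Finset.sum_congr rfl fun i _ => ?_
  rw [h _ _ i.1.2 i.2.2]

include hγ₂ in
theorem exists_levelEval_eq {V : OpenNormalSubgroup G} {m : ℕ}
    (hV : (congruenceSubgroup e m).toSubgroup ≤ V.toSubgroup)
    (b : MonoidAlgebra (ZMod p) (G ⧸ V.toSubgroup)) :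
    ∃ s : SkewFpSeries p ε, levelEval e γ₂ hγ₁ hV s = b := by
  have hb : b ∈ Submodule.span (ZMod p) (Set.range fun i : Fin (p ^ m) × Fin (p ^ m) =>
      (toLevel p V γ₁ - 1) ^ (i.1 : ℕ) * (toLevel p V γ₂ - 1) ^ (i.2 : ℕ)) := by
    rw [span_monomials_eq_top e hγ₁ hγ₂ hV]; trivial
  obtain ⟨c, hc⟩ := (Submodule.mem_span_range_iff_exists_fun _).mp hb
  refine ⟨⟨fun l => PowerSeries.mk fun k =>
    if h : k < p ^ m ∧ l < p ^ m then c (⟨k, h.1⟩, ⟨l, h.2⟩) else 0⟩, ?_⟩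
  rw [levelEval, skewEval_eq_sum, ← hc]
  refine Finset.sum_congr rfl fun i _ => ?_
  simp

/-- The value of a skew power series in the completed group algebra at `γ₁ - 1` and `γ₂ - 1`. -/
noncomputable def completedEval (hγ₁ : e γ₁ = SemidirectProduct.inl (Multiplicative.ofAdd 1))
    (hγ₂ : e γ₂ = SemidirectProduct.inr (Multiplicative.ofAdd 1)) (s : SkewFpSeries p ε) :
    CompletedGroupAlgebra (ZMod p) G :=
  ⟨fun V => levelEval e γ₂ hγ₁ (exists_congruenceSubgroup_le e V).choose_spec s,
    fun _ _ h => map_levelEval e hγ₁ hγ₂ _ _ h s⟩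

theorem completedEval_apply {V : OpenNormalSubgroup G} {m : ℕ}
    (hV : (congruenceSubgroup e m).toSubgroup ≤ V.toSubgroup) (s : SkewFpSeries p ε) :
    (completedEval e hγ₁ hγ₂ s).1 V = levelEval e γ₂ hγ₁ hV s := by
  have h := map_levelEval e hγ₁ hγ₂ hV (exists_congruenceSubgroup_le e V).choose_spec
    (le_refl V.toSubgroup) s
  have h' := map_levelEval e hγ₁ hγ₂ hV hV (le_refl V.toSubgroup) s
  exact h.symm.trans h'

theorem completedEval_injective :
    Function.Injective (completedEval e hγ₁ hγ₂ : SkewFpSeries p ε → _) := by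
  intro s t h
  ext l k
  have hp : 1 < p := (Fact.out : p.Prime).one_lt
  apply coeff_eq_of_levelEval_eq e hγ₁ hγ₂ (m := max k l)
  · rw [← completedEval_apply e hγ₁ hγ₂, h, completedEval_apply e hγ₁ hγ₂]
  · exact (le_max_left k l).trans_lt (Nat.lt_pow_self hp)
  · exact (le_max_right k l).trans_lt (Nat.lt_pow_self hp)

theorem completedEval_surjective :
    Function.Surjective (completedEval e hγ₁ hγ₂ : SkewFpSeries p ε → _) := by
  intro f
  have hp : 1 < p := (Fact.out : p.Prime).one_lt
  choose t ht using fun m => exists_levelEval_eq (ε := ε) e hγ₁ hγ₂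
    (le_refl (congruenceSubgroup e m).toSubgroup) (f.1 (congruenceSubgroup e m))
  have hcompat {m n : ℕ} (hmn : m ≤ n) {k l : ℕ} (hk : k < p ^ m) (hl : l < p ^ m) :
      PowerSeries.coeff k ((t n).coeff l) = PowerSeries.coeff k ((t m).coeff l) := by
    refine coeff_eq_of_levelEval_eq e hγ₁ hγ₂ (m := m) ?_ hk hl
    rw [ht m, ← map_levelEval e hγ₁ hγ₂ le_rfl le_rfl (congruenceSubgroup_anti e hmn), ht n]
    exact f.2 _ _ _
  let s : SkewFpSeries p ε :=
    ⟨fun l => PowerSeries.mk fun k => PowerSeries.coeff k ((t (max k l)).coeff l)⟩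
  have hs (m : ℕ) : levelEval e γ₂ hγ₁ (le_refl (congruenceSubgroup e m).toSubgroup) s =
      f.1 (congruenceSubgroup e m) := by
    rw [← ht m]
    apply levelEval_congr
    intro k l hk hl
    simp only [s, PowerSeries.coeff_mk]
    rcases le_total m (max k l) with h | h
    · exact hcompat h hk hl
    · exact (hcompat h ((le_max_left k l).trans_lt (Nat.lt_pow_self hp))
        ((le_max_right k l).trans_lt (Nat.lt_pow_self hp))).symm
  refine ⟨s, Subtype.ext (funext fun V => ?_)⟩
  obtain ⟨m, hm⟩ := exists_congruenceSubgroup_le e V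
  rw [completedEval_apply e hγ₁ hγ₂ hm, ← map_levelEval e hγ₁ hγ₂ le_rfl hm hm, hs]
  exact f.2 _ _ _

theorem toZMod_eq_one_of_eq_action (hε : ε = ρ (Multiplicative.ofAdd 1)) :
    PadicInt.toZMod ε = 1 := by
  rw [hε, toZMod_padicAction_one]

/-- The isomorphism `𝔽_p[[X,Y;σ,δ]] ≅ 𝔽_p[[G]]` with `X ↦ γ₁ - 1` and `Y ↦ γ₂ - 1`. -/
noncomputable def completedEvalEquiv
    (hγ₁ : e γ₁ = SemidirectProduct.inl (Multiplicative.ofAdd 1))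
    (hγ₂ : e γ₂ = SemidirectProduct.inr (Multiplicative.ofAdd 1))
    (hε : ε = ρ (Multiplicative.ofAdd 1)) :
    SkewFpSeries p ε ≃+* CompletedGroupAlgebra (ZMod p) G where
  toEquiv := Equiv.ofBijective _
    ⟨completedEval_injective e hγ₁ hγ₂, completedEval_surjective e hγ₁ hγ₂⟩
  map_add' s t := Subtype.ext (funext fun _ => skewEval_add _ s t)
  map_mul' s t := Subtype.ext (funext fun V => skewEval_mul _
    (toLevel_sub_one_pow_right e hγ₂ (exists_congruenceSubgroup_le e V).choose_spec)
    (toLevel_mul_nilEval e hγ₁ hγ₂ hε (exists_congruenceSubgroup_le e V).choose_spec _)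
    (toZMod_eq_one_of_eq_action hε) s t)

theorem completedEvalEquiv_C_X (hε : ε = ρ (Multiplicative.ofAdd 1)) :
    completedEvalEquiv e hγ₁ hγ₂ hε (SkewPowerSeries.C _ _ PowerSeries.X) =
      CompletedGroupAlgebra.of (ZMod p) γ₁ - 1 := by
  refine Subtype.ext (funext fun V => ?_)
  exact (skewEval_C _ (pow_ne_zero _ (Fact.out : p.Prime).ne_zero) _).trans (nilEval_X _)

theorem completedEvalEquiv_C_one (hε : ε = ρ (Multiplicative.ofAdd 1)) :
    completedEvalEquiv e hγ₁ hγ₂ hε (SkewPowerSeries.C _ _ 1) = 1 := by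
  refine Subtype.ext (funext fun V => ?_)
  exact (skewEval_C _ (pow_ne_zero _ (Fact.out : p.Prime).ne_zero) _).trans (map_one _)

theorem completedEvalEquiv_Y (hε : ε = ρ (Multiplicative.ofAdd 1)) :
    completedEvalEquiv e hγ₁ hγ₂ hε (SkewPowerSeries.Y _ _) =
      CompletedGroupAlgebra.of (ZMod p) γ₂ - 1 := by
  refine Subtype.ext (funext fun V => ?_)
  exact skewEval_Y _
    (toLevel_sub_one_pow_right e hγ₂ (exists_congruenceSubgroup_le e V).choose_spec)

theorem CompletedGroupAlgebra.isUnit_of {k G : Type*} [Ring k] [Group G] [TopologicalSpace G]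
    (g : G) : IsUnit (CompletedGroupAlgebra.of k g) := by
  have hone : CompletedGroupAlgebra.of k (1 : G) = 1 :=
    Subtype.ext (funext fun V => map_one (MonoidAlgebra.of k (G ⧸ V.toSubgroup)))
  have hmul (a b : G) : CompletedGroupAlgebra.of k a * CompletedGroupAlgebra.of k b =
      CompletedGroupAlgebra.of k (a * b) :=
    Subtype.ext (funext fun V => (map_mul (MonoidAlgebra.of k (G ⧸ V.toSubgroup)) _ _).symm)
  exact ⟨⟨CompletedGroupAlgebra.of k g, CompletedGroupAlgebra.of k g⁻¹,
    by rw [hmul, mul_inv_cancel, hone], by rw [hmul, inv_mul_cancel, hone]⟩, rfl⟩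

end Iso

/-! ### Rings that are complete with respect to a normal element -/

section NormalUniformizer

/-- `A` is separated and complete with respect to the regular element `x`, which generates the
kernel of the surjection `π : A → B` and commutes with all elements modulo `x²`. Divisibility
`x ^ n ∣ a` means `a ∈ xⁿA`, and completeness says that all series `∑ xⁱ qᵢ` converge. -/
structure IsNormalUniformizer {A B : Type*} [Ring A] [CommRing B] (x : A) (π : A →+* B) : Prop where
  surjective : Function.Surjective π
  dvd_of_map_eq_zero : ∀ a, π a = 0 → x ∣ a
  map_eq_zero : π x = 0
  mul_comm_mod : ∀ a, ∃ b, a * x = x * a + x * (x * b)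
  regular : ∀ a, x * a = 0 → a = 0
  separated : ∀ a, (∀ n, x ^ n ∣ a) → a = 0
  complete : ∀ q : ℕ → A, ∃ a, ∀ n, x ^ n ∣ a - ∑ i ∈ Finset.range n, x ^ i * q i

namespace IsNormalUniformizer

variable {A B : Type*} [Ring A] [CommRing B] {x : A} {π : A →+* B}

theorem exists_mul_eq_mul_self (h : IsNormalUniformizer x π) (a : A) :
    ∃ b, a * x = x * b ∧ π b = π a := by
  obtain ⟨b, hb⟩ := h.mul_comm_mod a
  exact ⟨a + x * b, by rw [hb, mul_add], by simp [h.map_eq_zero]⟩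

/-- The other half of the normality of `x`, by successive approximation: if
`x f = f x + x² f₁`, `x f₁ = f₁ x + x² f₂`, …, then `x f = (f + x f₁ + x² f₂ + ⋯) x`. -/
theorem exists_self_mul_eq_mul (h : IsNormalUniformizer x π) (a : A) :
    ∃ b, x * a = b * x ∧ π b = π a := by
  choose c hc using h.mul_comm_mod
  let f : ℕ → A := fun n => (fun t => -c t)^[n] a
  have hf (n : ℕ) : x * f n = f n * x + x * (x * f (n + 1)) := by
    have : f (n + 1) = -c (f n) := Function.iterate_succ_apply' _ _ _
    rw [this, hc (f n)]
    simp
  have hsum (n : ℕ) : x * a = (∑ i ∈ Finset.range n, x ^ i * f i) * x + x ^ n * (x * f n) := by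
    induction n with
    | zero => simp [f]
    | succ n ih =>
      rw [ih, hf n, Finset.sum_range_succ, add_mul, mul_add, pow_succ]
      simp only [mul_assoc, add_assoc]
  obtain ⟨q, hq⟩ := h.complete f
  refine ⟨q, ?_, ?_⟩
  · rw [← sub_eq_zero]
    refine h.separated _ fun n => ?_
    have h1 : x * a - q * x =
        x ^ n * (x * f n) - (q - ∑ i ∈ Finset.range n, x ^ i * f i) * x := by
      rw [hsum n, sub_mul]; abel
    rw [h1]
    exact dvd_sub (dvd_mul_right _ _) ((hq n).mul_right _)
  · obtain ⟨t, ht⟩ := hq 1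
    have := congrArg π ht
    rw [Finset.sum_range_one, pow_zero, one_mul, map_sub, map_mul, pow_one, h.map_eq_zero,
      zero_mul, sub_eq_zero] at this
    exact this

theorem exists_mul_pow_eq (h : IsNormalUniformizer x π) (a : A) (n : ℕ) :
    ∃ b, a * x ^ n = x ^ n * b ∧ π b = π a := by
  induction n with
  | zero => exact ⟨a, by simp, rfl⟩
  | succ n ih =>
    obtain ⟨b, hb, hb'⟩ := ih
    obtain ⟨c, hc, hc'⟩ := h.exists_mul_eq_mul_self b
    exact ⟨c, by rw [pow_succ, ← mul_assoc, hb, mul_assoc, hc, mul_assoc], hc'.trans hb'⟩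

theorem exists_pow_mul_eq (h : IsNormalUniformizer x π) (a : A) (n : ℕ) :
    ∃ b, x ^ n * a = b * x ^ n ∧ π b = π a := by
  induction n with
  | zero => exact ⟨a, by simp, rfl⟩
  | succ n ih =>
    obtain ⟨b, hb, hb'⟩ := ih
    obtain ⟨c, hc, hc'⟩ := h.exists_self_mul_eq_mul b
    exact ⟨c, by rw [pow_succ', mul_assoc, hb, ← mul_assoc, hc, mul_assoc], hc'.trans hb'⟩

theorem eq_zero_of_pow_mul (h : IsNormalUniformizer x π) {a : A} {n : ℕ} (ha : x ^ n * a = 0) :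
    a = 0 := by
  induction n with
  | zero => simpa using ha
  | succ n ih => exact ih (h.regular _ (by rwa [pow_succ', mul_assoc] at ha))

theorem exists_eq_pow_mul (h : IsNormalUniformizer x π) {a : A} (ha : a ≠ 0) :
    ∃ n c, a = x ^ n * c ∧ π c ≠ 0 := by
  classical
  have hex : ∃ n, ¬ x ^ n ∣ a := by
    by_contra! hcon
    exact ha (h.separated a hcon)
  obtain ⟨m, hm⟩ := Nat.exists_eq_succ_of_ne_zero (n := Nat.find hex) (by
    intro h0
    have := Nat.find_spec hex
    rw [h0, pow_zero] at this
    exact this (one_dvd a))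
  have hm1 : x ^ m ∣ a := not_not.mp (Nat.find_min hex (m := m) (by omega))
  obtain ⟨c, hc⟩ := hm1
  refine ⟨m, c, hc, fun h0 => ?_⟩
  obtain ⟨b, rfl⟩ := h.dvd_of_map_eq_zero c h0
  have := Nat.find_spec hex
  rw [hm] at this
  exact this ⟨b, by rw [hc, Nat.succ_eq_add_one, pow_succ, mul_assoc]⟩

/-- Writing `a = xᵐ a'` and `b = xⁿ b'` with `a'`, `b'` nonzero modulo `x` shows `a b ≠ 0`. -/
protected theorem isDomain [IsDomain B] (h : IsNormalUniformizer x π) : IsDomain A := by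
  have hnt : Nontrivial A := ⟨⟨0, 1, fun h01 => by simpa using congrArg π h01⟩⟩
  have : NoZeroDivisors A := by
    refine ⟨fun {a b} hab => ?_⟩
    by_contra! hne
    obtain ⟨m, a', rfl, ha'⟩ := h.exists_eq_pow_mul hne.1
    obtain ⟨n, b', rfl, hb'⟩ := h.exists_eq_pow_mul hne.2
    obtain ⟨c, hc, hc'⟩ := h.exists_mul_pow_eq a' n
    rw [mul_assoc, ← mul_assoc a', hc, mul_assoc] at hab
    have h0 := congrArg π (h.eq_zero_of_pow_mul (h.eq_zero_of_pow_mul hab))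
    rw [map_mul, map_zero, hc'] at h0
    exact (mul_ne_zero ha' hb') h0
  exact NoZeroDivisors.to_isDomain A

theorem ne_zero [Nontrivial B] (h : IsNormalUniformizer x π) : x ≠ 0 := by
  intro h0
  have h1 : (1 : A) = 0 := h.regular 1 (by rw [h0, zero_mul])
  exact one_ne_zero (by rw [← map_one π, h1, map_zero])

/-- The opposite ring is complete with respect to the same element. -/
protected theorem op [IsDomain B] (h : IsNormalUniformizer x π) :
    IsNormalUniformizer (MulOpposite.op x) (π.fromOpposite fun _ _ => Commute.all _ _) := by
  have := h.isDomain
  have hdvd (a : Aᵐᵒᵖ) (n : ℕ) : MulOpposite.op x ^ n ∣ a ↔ x ^ n ∣ a.unop := by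
    constructor
    · rintro ⟨c, rfl⟩
      obtain ⟨b, hb, -⟩ := h.exists_mul_pow_eq c.unop n
      exact ⟨b, by simpa using hb⟩
    · rintro ⟨c, hc⟩
      obtain ⟨b, hb, -⟩ := h.exists_pow_mul_eq c n
      exact ⟨MulOpposite.op b, MulOpposite.unop_injective (by simpa using hc.trans hb)⟩
  refine ⟨?_, ?_, h.map_eq_zero, ?_, ?_, ?_, ?_⟩
  · intro b
    obtain ⟨a, ha⟩ := h.surjective b
    exact ⟨MulOpposite.op a, ha⟩
  · intro a ha
    have := (hdvd a 1).mpr (by simpa using h.dvd_of_map_eq_zero a.unop ha)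
    simpa using this
  · intro a
    obtain ⟨b, hb, hb'⟩ := h.exists_self_mul_eq_mul a.unop
    obtain ⟨c, hc⟩ := h.dvd_of_map_eq_zero (b - a.unop) (by rw [map_sub, hb', sub_self])
    obtain ⟨d, hd, -⟩ := h.exists_self_mul_eq_mul c
    refine ⟨MulOpposite.op d, MulOpposite.unop_injective ?_⟩
    simp only [MulOpposite.unop_mul, MulOpposite.unop_op, MulOpposite.unop_add]
    rw [hb, ← hd, ← hc]
    noncomm_ring
  · intro a ha
    have : a.unop * x = 0 := congrArg MulOpposite.unop ha
    exact MulOpposite.unop_injective ((mul_eq_zero.mp this).resolve_right h.ne_zero)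
  · intro a ha
    exact MulOpposite.unop_injective (h.separated _ fun n => (hdvd a n).mp (ha n))
  · intro q
    choose q' hq' _ using fun i => h.exists_mul_pow_eq (q i).unop i
    obtain ⟨a, ha⟩ := h.complete q'
    refine ⟨MulOpposite.op a, fun n => (hdvd _ n).mpr ?_⟩
    have h1 : (∑ i ∈ Finset.range n, MulOpposite.op x ^ i * q i).unop =
        ∑ i ∈ Finset.range n, x ^ i * q' i := by
      rw [Finset.unop_sum]
      refine Finset.sum_congr rfl fun i _ => ?_
      rw [← hq']; rfl
    rw [MulOpposite.unop_sub, h1]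
    exact ha n

/-- The ideal of the values at `π` of the elements `c` with `c xᵏ ∈ I`. -/
def leadingIdeal (h : IsNormalUniformizer x π) (I : Ideal A) (k : ℕ) : Ideal B where
  carrier := {b | ∃ c, π c = b ∧ c * x ^ k ∈ I}
  add_mem' := by
    rintro _ _ ⟨c, rfl, hc⟩ ⟨d, rfl, hd⟩
    exact ⟨c + d, map_add _ _ _, by rw [add_mul]; exact I.add_mem hc hd⟩
  zero_mem' := ⟨0, map_zero _, by rw [zero_mul]; exact I.zero_mem⟩
  smul_mem' := by
    rintro b _ ⟨c, rfl, hc⟩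
    obtain ⟨a, rfl⟩ := h.surjective b
    exact ⟨a * c, map_mul _ _ _, by rw [mul_assoc]; exact I.mul_mem_left a hc⟩

theorem leadingIdeal_mono (h : IsNormalUniformizer x π) (I : Ideal A) :
    Monotone (h.leadingIdeal I) := by
  refine monotone_nat_of_le_succ fun k => ?_
  rintro _ ⟨c, rfl, hc⟩
  obtain ⟨d, hd, hd'⟩ := h.exists_self_mul_eq_mul c
  refine ⟨d, hd', ?_⟩
  rw [pow_succ', ← mul_assoc, ← hd, mul_assoc]
  exact I.mul_mem_left x hc

/-- The ring `A` is left Noetherian if `A / xA` is a principal ideal ring: the leading ideals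
`L₀ ⊆ L₁ ⊆ ⋯` of a left ideal become stationary at some `K`, and elements `cₖ xᵏ` whose leading
coefficients generate `Lₖ`, for `k ≤ K`, generate the ideal. -/
protected theorem isNoetherianRing [IsPrincipalIdealRing B] (h : IsNormalUniformizer x π) :
    IsNoetherianRing A := by
  classical
  refine ⟨fun (I : Ideal A) => ?_⟩
  obtain ⟨K, hK⟩ := WellFoundedGT.monotone_chain_condition
    (⟨h.leadingIdeal I, h.leadingIdeal_mono I⟩ : ℕ →o Ideal B)
  have hgen (k : ℕ) : ∃ c, c * x ^ k ∈ I ∧ h.leadingIdeal I k = Ideal.span {π c} := by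
    obtain ⟨b, hb⟩ := (IsPrincipalIdealRing.principal (h.leadingIdeal I k)).principal
    have hmem : b ∈ h.leadingIdeal I k := by rw [hb]; exact Submodule.mem_span_singleton_self b
    obtain ⟨c, rfl, hc⟩ := hmem
    exact ⟨c, hc, hb⟩
  choose c hcI hcL using hgen
  let J : Ideal A := Ideal.span ((Finset.range (K + 1)).image fun k => c k * x ^ k : Finset A)
  have hcJ {k : ℕ} (hk : k ≤ K) : c k * x ^ k ∈ J := by
    apply Ideal.subset_span
    rw [Finset.mem_coe, Finset.mem_image]
    exact ⟨k, by simpa [Nat.lt_succ_iff] using hk, rfl⟩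
  have hJI : J ≤ I := by
    rw [Ideal.span_le]
    intro f hf
    rw [Finset.mem_coe, Finset.mem_image] at hf
    obtain ⟨k, -, rfl⟩ := hf
    exact hcI k
  -- one step of the reduction modulo a generator in degree `k ≤ K`
  have hstep (k n : ℕ) (hL : h.leadingIdeal I (k + n) = h.leadingIdeal I k) (d : A)
      (hd : d * x ^ (k + n) ∈ I) : ∃ u d', d * x ^ (k + n) =
        x ^ n * u * (c k * x ^ k) + d' * x ^ (k + (n + 1)) := by
    have h1 : π d ∈ h.leadingIdeal I k := by rw [← hL]; exact ⟨d, rfl, hd⟩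
    rw [hcL k, Ideal.mem_span_singleton'] at h1
    obtain ⟨b, hb⟩ := h1
    obtain ⟨w, rfl⟩ := h.surjective b
    obtain ⟨u, hu, -⟩ := h.exists_mul_pow_eq w n
    obtain ⟨c', hc', hc''⟩ := h.exists_pow_mul_eq (c k) n
    have h2 : x ^ n * u * (c k * x ^ k) = w * c' * x ^ (k + n) := by
      rw [← hu, mul_assoc, ← mul_assoc (x ^ n), hc', add_comm k n, pow_add]
      simp only [mul_assoc]
    obtain ⟨t, ht⟩ := h.dvd_of_map_eq_zero (d - w * c') (by
      rw [map_sub, map_mul, hc'', hb, sub_self])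
    obtain ⟨d', hd', -⟩ := h.exists_self_mul_eq_mul t
    refine ⟨u, d', ?_⟩
    rw [h2, ← add_assoc k n 1, pow_succ', ← mul_assoc d', ← hd', ← ht]
    noncomm_ring
  -- the elements of `I` in `A x^K` are multiples of the generator in degree `K`
  have htop (d : A) (hd : d * x ^ K ∈ I) : d * x ^ K ∈ J := by
    have hL (n : ℕ) : h.leadingIdeal I (K + n) = h.leadingIdeal I K := (hK (K + n) (by omega)).symm
    have hstep' (n : ℕ) (d : A) : ∃ u d', d * x ^ (K + n) ∈ I → d * x ^ (K + n) =
        x ^ n * u * (c K * x ^ K) + d' * x ^ (K + (n + 1)) := by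
      by_cases hdI : d * x ^ (K + n) ∈ I
      · obtain ⟨u, d', hu⟩ := hstep K n (hL n) d hdI
        exact ⟨u, d', fun _ => hu⟩
      · exact ⟨0, 0, fun hcon => absurd hcon hdI⟩
    choose u d' hud using hstep'
    let D : ℕ → A := fun n => Nat.rec d (fun n t => d' n t) n
    have hD (n : ℕ) : D (n + 1) = d' n (D n) := rfl
    have hDI (n : ℕ) : D n * x ^ (K + n) ∈ I := by
      induction n with
      | zero => exact hd
      | succ n ih =>
        have h1 := hud n (D n) ih
        rw [← hD n] at h1
        rw [eq_sub_of_add_eq' h1.symm]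
        exact I.sub_mem ih (I.mul_mem_left _ (hcI K))
    have hsum (n : ℕ) : d * x ^ K = (∑ i ∈ Finset.range n, x ^ i * u i (D i)) * (c K * x ^ K) +
        D n * x ^ (K + n) := by
      induction n with
      | zero => simp [D]
      | succ n ih =>
        rw [ih, hud n (D n) (hDI n), ← hD n, Finset.sum_range_succ, add_mul, add_assoc]
    obtain ⟨q, hq⟩ := h.complete fun i => u i (D i)
    have h0 : d * x ^ K - q * (c K * x ^ K) = 0 := by
      refine h.separated _ fun n => ?_
      have h1 : d * x ^ K - q * (c K * x ^ K) = D n * x ^ (K + n) -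
          (q - ∑ i ∈ Finset.range n, x ^ i * u i (D i)) * (c K * x ^ K) := by
        rw [hsum n, sub_mul]; abel
      obtain ⟨t, ht, -⟩ := h.exists_mul_pow_eq (D n) (K + n)
      rw [h1, ht, add_comm K n, pow_add, mul_assoc (x ^ n)]
      exact dvd_sub (dvd_mul_right _ _) ((hq n).mul_right _)
    rw [sub_eq_zero.mp h0]
    exact J.mul_mem_left _ (hcJ le_rfl)
  have hall (n : ℕ) : ∀ k, k + n = K → ∀ d, d * x ^ k ∈ I → d * x ^ k ∈ J := by
    induction n with
    | zero => rintro k rfl; exact htop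
    | succ n ih =>
      intro k hk d hd
      obtain ⟨u, d', hud⟩ := hstep k 0 rfl d hd
      simp only [add_zero, pow_zero, one_mul, zero_add] at hud
      have h1 : d' * x ^ (k + 1) ∈ I := by
        rw [eq_sub_of_add_eq' hud.symm]
        exact I.sub_mem hd (I.mul_mem_left _ (hcI k))
      rw [hud]
      exact J.add_mem (J.mul_mem_left _ (hcJ (by omega))) (ih (k + 1) (by omega) d' h1)
  have hIJ : I = J := le_antisymm
    (fun d hd => by simpa using hall K 0 (zero_add K) d (by simpa using hd)) hJI
  exact ⟨_, hIJ.symm⟩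

end IsNormalUniformizer

end NormalUniformizer

/-! ### Weierstrass division and prime ideals -/

section Prime

variable {A : Type*} [Ring A]

theorem IsNormalUniformizer.mem_or_mem_of_pow_mul_mem {B : Type*} [CommRing B] {x : A} {π : A →+* B}
    (h : IsNormalUniformizer x π) {P : TwoSidedIdeal A} (hP : IsPrimeTwoSided P) {n : ℕ} {b : A}
    (hb : x ^ n * b ∈ P) : x ∈ P ∨ b ∈ P := by
  induction n with
  | zero => right; simpa using hb
  | succ n ih =>
    rw [pow_succ', mul_assoc] at hb
    rcases hP.2 x (x ^ n * b) (fun a => by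
      obtain ⟨c, hc, -⟩ := h.exists_self_mul_eq_mul a
      rw [hc, mul_assoc]
      exact P.mul_mem_left _ _ hb) with h1 | h1
    · exact Or.inl h1
    · exact ih h1

variable {k : Type*} [Field k] {x : A} {π : A →+* PowerSeries k} {ev : PowerSeries k →+* A}
  {u : A}

theorem PowerSeries.exists_trunc_eq_sum_one_add_X_pow (f : PowerSeries k) (d : ℕ) :
    ∃ c : ℕ → k, (PowerSeries.trunc d f : PowerSeries k) =
      ∑ i ∈ Finset.range d, PowerSeries.C (c i) * (1 + PowerSeries.X) ^ i := by
  set g := PowerSeries.trunc d f with hg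
  refine ⟨fun i => (Polynomial.taylor (-1) g).coeff i, ?_⟩
  have hdeg : (Polynomial.taylor (-1) g).degree < d := by
    rw [Polynomial.degree_taylor]; exact PowerSeries.degree_trunc_lt f d
  have h1 : Polynomial.taylor (-1) g = ∑ i ∈ Finset.range d,
      Polynomial.C ((Polynomial.taylor (-1) g).coeff i) * Polynomial.X ^ i := by
    ext j
    simp only [Polynomial.finsetSum_coeff, Polynomial.coeff_C_mul_X_pow]
    rw [Finset.sum_ite_eq]
    split_ifs with hj
    · rfl
    · exact Polynomial.coeff_eq_zero_of_degree_lt (hdeg.trans_le (by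
        exact_mod_cast not_lt.mp (fun h => hj (Finset.mem_range.mpr h))))
  have h2 := congrArg (Polynomial.taylor 1) h1
  rw [Polynomial.taylor_taylor, add_neg_cancel, Polynomial.taylor_zero, map_sum] at h2
  have h3 := congrArg (Polynomial.coeToPowerSeries.ringHom (R := k)) h2
  rw [map_sum] at h3
  simp only [Polynomial.coeToPowerSeries.ringHom_apply] at h3
  rw [h3]
  refine Finset.sum_congr rfl fun i _ => ?_
  simp [Polynomial.taylor_mul, Polynomial.taylor_pow, add_comm]

/-- Weierstrass division by an element `b` of `A` whose reduction `π b` is nonzero of order `d`. The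
remainder is a polynomial of degree less than `d` in `u`, where `u` lifts `1 + Y`. -/
theorem IsNormalUniformizer.exists_weierstrass_division (h : IsNormalUniformizer x π)
    (hev : ev PowerSeries.X = x) (hπC : ∀ a, π (ev (PowerSeries.C a)) = PowerSeries.C a)
    (hπu : π u = 1 + PowerSeries.X) {b : A} (hb : π b ≠ 0) :
    ∃ d, ∀ f, ∃ (q : A) (r : ℕ → PowerSeries k),
      f = q * b + ∑ i ∈ Finset.range d, ev (r i) * u ^ i := by
  obtain ⟨d, v, hv⟩ := IsDiscreteValuationRing.associated_pow_irreducible hb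
    (PowerSeries.X_prime (R := k)).irreducible
  refine ⟨d, fun f => ?_⟩
  have hstep (f : A) : ∃ (q : A) (c : ℕ → k) (g : A), f = q * b +
      ∑ i ∈ Finset.range d, ev (PowerSeries.C (c i)) * u ^ i + x * g := by
    obtain ⟨c, hc⟩ := PowerSeries.exists_trunc_eq_sum_one_add_X_pow (π f) d
    have hf := PowerSeries.eq_X_pow_mul_shift_add_trunc d (π f)
    set w := PowerSeries.mk fun i => PowerSeries.coeff (i + d) (π f)
    obtain ⟨q, hq⟩ := h.surjective (v * w)
    obtain ⟨g, hg⟩ := h.dvd_of_map_eq_zero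
      (f - (q * b + ∑ i ∈ Finset.range d, ev (PowerSeries.C (c i)) * u ^ i)) (by
        simp only [map_sub, map_add, map_mul, map_sum, map_pow, hπC, hπu, hq]
        rw [← hc]
        linear_combination hf - w * hv)
    exact ⟨q, c, g, by rw [← hg]; abel⟩
  choose q c g hg using hstep
  let F : ℕ → A := fun n => g^[n] f
  have hF (n : ℕ) : F (n + 1) = g (F n) := Function.iterate_succ_apply' _ _ _
  have hsum (n : ℕ) : f = (∑ j ∈ Finset.range n, x ^ j * q (F j)) * b +
      ∑ i ∈ Finset.range d, (∑ j ∈ Finset.range n, x ^ j * ev (PowerSeries.C (c (F j) i))) * u ^ i +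
      x ^ n * F n := by
    induction n with
    | zero => simp [F]
    | succ n ih =>
      have h1 : x ^ n * F n = x ^ n * q (F n) * b +
          ∑ i ∈ Finset.range d, x ^ n * ev (PowerSeries.C (c (F n) i)) * u ^ i +
          x ^ (n + 1) * F (n + 1) := by
        conv_lhs => rw [hg (F n)]
        rw [hF, mul_add, mul_add, Finset.mul_sum, pow_succ]
        simp only [mul_assoc]
      conv_lhs => rw [ih, h1]
      simp only [Finset.sum_range_succ, add_mul, Finset.sum_add_distrib]
      abel
  obtain ⟨Q, hQ⟩ := h.complete fun j => q (F j)
  let r : ℕ → PowerSeries k := fun i => PowerSeries.mk fun j => c (F j) i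
  have hr (i n : ℕ) :
      x ^ n ∣ ev (r i) - ∑ j ∈ Finset.range n, x ^ j * ev (PowerSeries.C (c (F j) i)) := by
    have h1 : PowerSeries.X ^ n ∣ r i - ∑ j ∈ Finset.range n,
        PowerSeries.X ^ j * PowerSeries.C (c (F j) i) := by
      rw [PowerSeries.X_pow_dvd_iff]
      intro m hm
      simp [r, PowerSeries.coeff_X_pow, hm]
    obtain ⟨t, ht⟩ := h1
    refine ⟨ev t, ?_⟩
    have h2 := congrArg ev ht
    simpa only [map_sub, map_sum, map_mul, map_pow, hev] using h2
  refine ⟨Q, r, sub_eq_zero.mp (h.separated _ fun n => ?_)⟩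
  have h1 : f - (Q * b + ∑ i ∈ Finset.range d, ev (r i) * u ^ i) = x ^ n * F n -
      (Q - ∑ j ∈ Finset.range n, x ^ j * q (F j)) * b - ∑ i ∈ Finset.range d,
        (ev (r i) - ∑ j ∈ Finset.range n, x ^ j * ev (PowerSeries.C (c (F j) i))) * u ^ i := by
    conv_lhs => rw [hsum n]
    simp only [sub_mul, Finset.sum_sub_distrib]
    abel
  rw [h1]
  exact dvd_sub (dvd_sub (dvd_mul_right _ _) ((hQ n).mul_right _))
    (Finset.dvd_sum fun i _ => (hr i n).mul_right _)

/-- If a two-sided ideal contains a nonzero polynomial in `u` with coefficients in `k[[X]]`, it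
contains a nonzero power series in `X`. As `u` acts on `k[[X]]` by `σ` and the series `σⁿ(X)` are
distinct, the top term of a polynomial `f` is cancelled in `f X - σᵈ(X) f`, and the other
coefficients are multiplied by nonzero factors. -/
theorem TwoSidedIdeal.exists_ne_zero_mem_of_eval₂_mem {σ : PowerSeries k →+* PowerSeries k}
    (hu : IsUnit u) (hσ : ∀ r, u * ev r = ev (σ r) * u)
    (hinj : Function.Injective fun n : ℕ => σ^[n] PowerSeries.X)
    (P : TwoSidedIdeal A) (f : Polynomial (PowerSeries k)) (hf : f ≠ 0)
    (hfP : Polynomial.eval₂ ev u f ∈ P) : ∃ r ≠ 0, ev r ∈ P := by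
  have hpow (n : ℕ) (r : PowerSeries k) : u ^ n * ev r = ev (σ^[n] r) * u ^ n := by
    induction n with
    | zero => simp
    | succ n ih =>
      rw [pow_succ', mul_assoc, ih, ← mul_assoc, hσ, mul_assoc, Function.iterate_succ_apply']
  induction hn : f.support.card using Nat.strong_induction_on generalizing f with
  | _ n ih =>
    subst hn
    set d := f.natDegree with hd
    have hdf : f.coeff d ≠ 0 := Polynomial.leadingCoeff_ne_zero.mpr hf
    -- the polynomial `f X - σᵈ(X) f`
    let g : Polynomial (PowerSeries k) := f.sum fun n r =>
      Polynomial.monomial n (r * (σ^[n] PowerSeries.X - σ^[d] PowerSeries.X))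
    have hgcoeff (j : ℕ) : g.coeff j =
        f.coeff j * (σ^[j] PowerSeries.X - σ^[d] PowerSeries.X) := by
      simp only [g, Polynomial.sum_def, Polynomial.finsetSum_coeff, Polynomial.coeff_monomial]
      rw [Finset.sum_ite_eq']
      split_ifs with hj
      · rfl
      · rw [Polynomial.notMem_support_iff.mp hj, zero_mul]
    have hgP : Polynomial.eval₂ ev u g ∈ P := by
      have h1 : Polynomial.eval₂ ev u g = Polynomial.eval₂ ev u f * ev PowerSeries.X -
          ev (σ^[d] PowerSeries.X) * Polynomial.eval₂ ev u f := by
        simp only [g, Polynomial.sum_def, Polynomial.eval₂_finsetSum, Polynomial.eval₂_monomial]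
        rw [Polynomial.eval₂_eq_sum, Polynomial.sum_def, Finset.sum_mul, Finset.mul_sum,
          ← Finset.sum_sub_distrib]
        refine Finset.sum_congr rfl fun j _ => ?_
        rw [mul_assoc (ev _), hpow, mul_sub, map_sub, map_mul, sub_mul, mul_assoc,
          mul_comm (f.coeff j) (σ^[d] _), map_mul, mul_assoc]
      rw [h1]
      exact P.sub_mem (P.mul_mem_right _ _ hfP) (P.mul_mem_left _ _ hfP)
    by_cases hg : g = 0
    · refine ⟨f.coeff d, hdf, ?_⟩
      have h1 : f = Polynomial.monomial d (f.coeff d) := by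
        ext1 j
        rw [Polynomial.coeff_monomial]
        split_ifs with hj
        · rw [hj]
        · have h2 := hgcoeff j
          rw [hg, Polynomial.coeff_zero, zero_eq_mul] at h2
          refine h2.resolve_right (sub_ne_zero.mpr fun h3 => hj (hinj h3).symm)
      rw [h1, Polynomial.eval₂_monomial] at hfP
      obtain ⟨w, hw⟩ := (hu.pow d).exists_right_inv
      have := P.mul_mem_right _ w hfP
      rwa [mul_assoc, hw, mul_one] at this
    · refine ih _ ?_ g hg hgP rfl
      apply Finset.card_lt_card
      rw [Finset.ssubset_iff_of_subset]
      · exact ⟨d, Polynomial.mem_support_iff.mpr hdf, by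
          rw [Polynomial.mem_support_iff, hgcoeff, sub_self, mul_zero, ne_eq, not_not]⟩
      · intro j hj
        rw [Polynomial.mem_support_iff, hgcoeff] at hj
        exact Polynomial.mem_support_iff.mpr (left_ne_zero_of_mul hj)

/-- Every nonzero prime ideal contains `x`. -/
theorem IsNormalUniformizer.mem_of_isPrimeTwoSided (h : IsNormalUniformizer x π)
    (hev : ev PowerSeries.X = x) (hπC : ∀ a, π (ev (PowerSeries.C a)) = PowerSeries.C a)
    (hπu : π u = 1 + PowerSeries.X) {σ : PowerSeries k →+* PowerSeries k}
    (hu : IsUnit u) (hσ : ∀ r, u * ev r = ev (σ r) * u)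
    (hinj : Function.Injective fun n : ℕ => σ^[n] PowerSeries.X)
    {P : TwoSidedIdeal A} (hP : IsPrimeTwoSided P) (hP0 : P ≠ ⊥) : x ∈ P := by
  by_contra hx
  obtain ⟨a, haP, ha⟩ : ∃ a ∈ P, a ≠ 0 := by
    by_contra! hcon
    exact hP0 (le_bot_iff.mp fun a ha => (TwoSidedIdeal.mem_bot A).mpr (hcon a ha))
  obtain ⟨n, b, rfl, hb⟩ := h.exists_eq_pow_mul ha
  have hbP : b ∈ P := (h.mem_or_mem_of_pow_mul_mem hP haP).resolve_left hx
  obtain ⟨d, hd⟩ := h.exists_weierstrass_division hev hπC hπu hb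
  obtain ⟨q, r, hqr⟩ := hd (u ^ d)
  -- a monic polynomial of degree `d` in `u` that lies in `P`
  let f : Polynomial (PowerSeries k) := Polynomial.X ^ d -
    ∑ i ∈ Finset.range d, Polynomial.monomial i (r i)
  have hf : f ≠ 0 := by
    intro h0
    have h1 := congrArg (fun g => Polynomial.coeff g d) h0
    simp [f, Polynomial.coeff_monomial] at h1
  have hfP : Polynomial.eval₂ ev u f ∈ P := by
    have h1 : Polynomial.eval₂ ev u f = q * b := by
      have h2 : f + ∑ i ∈ Finset.range d, Polynomial.monomial i (r i) = Polynomial.X ^ d :=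
        sub_add_cancel _ _
      have h3 := congrArg (Polynomial.eval₂ ev u) h2
      rw [Polynomial.eval₂_add, Polynomial.eval₂_finsetSum, Polynomial.eval₂_X_pow, hqr] at h3
      simp only [Polynomial.eval₂_monomial] at h3
      exact add_right_cancel h3
    rw [h1]
    exact P.mul_mem_left _ _ hbP
  obtain ⟨s, hs, hsP⟩ := TwoSidedIdeal.exists_ne_zero_mem_of_eval₂_mem hu hσ hinj P f hf hfP
  obtain ⟨m, v, hv⟩ := IsDiscreteValuationRing.associated_pow_irreducible hs
    (PowerSeries.X_prime (R := k)).irreducible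
  have hxm : x ^ m * 1 ∈ P := by
    have := P.mul_mem_right _ (ev v) hsP
    rwa [← map_mul, hv, map_pow, hev, ← mul_one (x ^ m)] at this
  rcases h.mem_or_mem_of_pow_mul_mem hP hxm with h1 | h1
  · exact hx h1
  · exact hP.1 ((TwoSidedIdeal.one_mem_iff P).mp h1)

end Prime

/-! ### The skew power series ring is complete with respect to `X` -/

section SkewRing

variable {p : ℕ} [Fact p.Prime] {ε : ℤ_[p]} {A : Type*} [Ring A] (Ψ : SkewFpSeries p ε ≃+* A)

/-- The additive map that sends an element of a ring isomorphic to `𝔽_p[[X,Y;σ,δ]]` to its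
coefficient at `Yⁿ`. -/
noncomputable def skewCoeffHom (n : ℕ) : A →+ PowerSeries (ZMod p) :=
  AddMonoidHom.mk' (fun a => (Ψ.symm a).coeff n) fun a b => by
    rw [map_add, SkewPowerSeries.coeff_add]

theorem skewCoeffHom_apply (s : SkewFpSeries p ε) (n : ℕ) :
    skewCoeffHom Ψ n (Ψ s) = s.coeff n :=
  congrArg (fun t : SkewFpSeries p ε => t.coeff n) (Ψ.symm_apply_apply s)

theorem skewCoeffHom_ext {a b : A} (h : ∀ n, skewCoeffHom Ψ n a = skewCoeffHom Ψ n b) : a = b :=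
  Ψ.symm.injective (SkewPowerSeries.ext (funext h))

/-- The inclusion of `𝔽_p[[X]]`. -/
noncomputable def skewConst (h1 : Ψ (SkewPowerSeries.C _ _ 1) = 1) : PowerSeries (ZMod p) →+* A :=
  RingHom.mk'
    { toFun := fun r => Ψ (SkewPowerSeries.C _ _ r)
      map_one' := h1
      map_mul' := fun r s => by
        rw [← map_mul]
        congr 1
        ext1
        funext n
        rw [SkewPowerSeries.coeff_C_mul, SkewPowerSeries.coeff_C, SkewPowerSeries.coeff_C, mul_ite,
          mul_zero] }
    fun r s => by
      change Ψ _ = Ψ _ + Ψ _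
      rw [← map_add]
      congr 1
      ext1
      funext n
      rw [SkewPowerSeries.coeff_add, SkewPowerSeries.coeff_C, SkewPowerSeries.coeff_C,
        SkewPowerSeries.coeff_C]
      split_ifs <;> simp

variable (h1 : Ψ (SkewPowerSeries.C _ _ 1) = 1)

theorem skewConst_apply (r : PowerSeries (ZMod p)) :
    skewConst Ψ h1 r = Ψ (SkewPowerSeries.C _ _ r) := rfl

theorem skewCoeffHom_skewConst (r : PowerSeries (ZMod p)) (n : ℕ) :
    skewCoeffHom Ψ n (skewConst Ψ h1 r) = if n = 0 then r else 0 := by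
  rw [skewConst_apply, skewCoeffHom_apply, SkewPowerSeries.coeff_C]

theorem skewCoeffHom_skewConst_mul (r : PowerSeries (ZMod p)) (a : A) (n : ℕ) :
    skewCoeffHom Ψ n (skewConst Ψ h1 r * a) = r * skewCoeffHom Ψ n a := by
  obtain ⟨s, rfl⟩ := Ψ.surjective a
  rw [skewConst_apply, ← map_mul, skewCoeffHom_apply, skewCoeffHom_apply,
    SkewPowerSeries.coeff_C_mul]

theorem skewConst_dvd_iff (r : PowerSeries (ZMod p)) (a : A) :
    skewConst Ψ h1 r ∣ a ↔ ∀ n, r ∣ skewCoeffHom Ψ n a := by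
  constructor
  · rintro ⟨b, rfl⟩ n
    exact ⟨_, skewCoeffHom_skewConst_mul Ψ h1 r b n⟩
  · intro h
    choose c hc using h
    refine ⟨Ψ ⟨c⟩, skewCoeffHom_ext Ψ fun n => ?_⟩
    rw [skewCoeffHom_skewConst_mul, skewCoeffHom_apply, hc]

/-- The relation `(1 + Y) r = σ(r) (1 + Y)`. -/
theorem one_add_Y_mul_skewConst (r : PowerSeries (ZMod p)) :
    (1 + Ψ (SkewPowerSeries.Y _ _)) * skewConst Ψ h1 r =
      skewConst Ψ h1 (sigmaHom p ε r) * (1 + Ψ (SkewPowerSeries.Y _ _)) := by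
  have key : Ψ (SkewPowerSeries.Y _ _) * skewConst Ψ h1 r =
      skewConst Ψ h1 (sigmaHom p ε r) * Ψ (SkewPowerSeries.Y _ _) +
        skewConst Ψ h1 (deltaHom p ε r) := by
    refine skewCoeffHom_ext Ψ fun n => ?_
    rw [map_add, skewCoeffHom_skewConst_mul, skewCoeffHom_skewConst, skewConst_apply, ← map_mul,
      skewCoeffHom_apply, skewCoeffHom_apply, SkewPowerSeries.coeff_mul_C]
    match n with
    | 0 =>
      rw [tsum_eq_single 1]
      · simp [SkewPowerSeries.Y, skewCoeff]
      · intro i hi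
        simp [SkewPowerSeries.Y, hi]
    | 1 =>
      rw [tsum_eq_single 0]
      · simp [SkewPowerSeries.Y, skewCoeff]
      · intro i hi
        simp [SkewPowerSeries.Y, hi]
    | n + 2 =>
      have h0 (i : ℕ) : n + 2 + i ≠ 1 := by omega
      simp [SkewPowerSeries.Y, h0]
  have hδ : deltaHom p ε r = sigmaHom p ε r - r := rfl
  rw [add_mul, one_mul, mul_add, mul_one, key, hδ, map_sub]
  abel

theorem constantCoeff_sigmaHom_iterate (hε : PadicInt.toZMod ε = 1) (n : ℕ)
    (r : PowerSeries (ZMod p)) :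
    PowerSeries.constantCoeff ((sigmaHom p ε)^[n] r) = PowerSeries.constantCoeff r := by
  induction n with
  | zero => rfl
  | succ n ih =>
    have h := X_dvd_sigmaHom_sub p ε ((sigmaHom p ε)^[n] r) hε
    rw [PowerSeries.X_dvd_iff, map_sub, sub_eq_zero] at h
    rw [Function.iterate_succ_apply', h, ih]

/-- The reduction modulo `X`, with values in `𝔽_p[[Y]]`. -/
noncomputable def skewReduction (h1 : Ψ (SkewPowerSeries.C _ _ 1) = 1)
    (hε : PadicInt.toZMod ε = 1) : A →+* PowerSeries (ZMod p) :=
  RingHom.mk'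
    { toFun := fun a => PowerSeries.mk fun n => PowerSeries.constantCoeff (skewCoeffHom Ψ n a)
      map_one' := by
        ext n
        rw [← map_one (skewConst Ψ h1)]
        simp only [skewCoeffHom_skewConst, PowerSeries.coeff_mk, PowerSeries.coeff_one]
        split_ifs <;> simp
      map_mul' := fun a b => by
        obtain ⟨s, rfl⟩ := Ψ.surjective a
        obtain ⟨t, rfl⟩ := Ψ.surjective b
        rw [← map_mul, mul_comm]
        ext n
        simp only [skewCoeffHom_apply, PowerSeries.coeff_mk]
        rw [PowerSeries.coeff_mul, Finset.Nat.sum_antidiagonal_eq_sum_range_succ_mk]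
        have h := SkewPowerSeries.X_pow_dvd_coeff_mul_sub hε s t n 1
        rw [pow_one, PowerSeries.X_dvd_iff, map_sub, sub_eq_zero] at h
        rw [h, map_sum]
        refine Finset.sum_congr rfl fun j _ => ?_
        rw [Finset.sum_range_one, add_zero, skewCoeff_self, map_mul,
          constantCoeff_sigmaHom_iterate hε, mul_comm, PowerSeries.coeff_mk, PowerSeries.coeff_mk] }
    fun a b => by
      ext n
      simp

theorem coeff_skewReduction (hε : PadicInt.toZMod ε = 1) (a : A) (n : ℕ) :
    PowerSeries.coeff n (skewReduction Ψ h1 hε a) =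
      PowerSeries.constantCoeff (skewCoeffHom Ψ n a) :=
  PowerSeries.coeff_mk n fun n => PowerSeries.constantCoeff (skewCoeffHom Ψ n a)

theorem skewReduction_skewConst (hε : PadicInt.toZMod ε = 1) (r : PowerSeries (ZMod p)) :
    skewReduction Ψ h1 hε (skewConst Ψ h1 r) = PowerSeries.C (PowerSeries.constantCoeff r) := by
  ext n
  rw [coeff_skewReduction, skewCoeffHom_skewConst, PowerSeries.coeff_C]
  split_ifs <;> simp

theorem skewReduction_Y (hε : PadicInt.toZMod ε = 1) :
    skewReduction Ψ h1 hε (Ψ (SkewPowerSeries.Y _ _)) = PowerSeries.X := by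
  ext n
  rw [coeff_skewReduction, skewCoeffHom_apply, PowerSeries.coeff_X]
  simp only [SkewPowerSeries.Y]
  split_ifs <;> simp

theorem isNormalUniformizer_skewConst_X (hε : PadicInt.toZMod ε = 1) :
    IsNormalUniformizer (skewConst Ψ h1 PowerSeries.X) (skewReduction Ψ h1 hε) := by
  have hdvd (n : ℕ) (a : A) : skewConst Ψ h1 PowerSeries.X ^ n ∣ a ↔
      ∀ m, PowerSeries.X ^ n ∣ skewCoeffHom Ψ m a := by
    rw [← map_pow, skewConst_dvd_iff]
  refine ⟨?_, ?_, ?_, ?_, ?_, ?_, ?_⟩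
  · intro b
    refine ⟨Ψ ⟨fun n => PowerSeries.C (PowerSeries.coeff n b)⟩, ?_⟩
    ext n
    rw [coeff_skewReduction, skewCoeffHom_apply, PowerSeries.constantCoeff_C]
  · intro a ha
    rw [skewConst_dvd_iff]
    intro n
    rw [PowerSeries.X_dvd_iff, ← coeff_skewReduction Ψ h1 hε, ha, map_zero]
  · rw [skewReduction_skewConst, PowerSeries.constantCoeff_X, map_zero]
  · intro a
    suffices skewConst Ψ h1 PowerSeries.X ^ 2 ∣
        a * skewConst Ψ h1 PowerSeries.X - skewConst Ψ h1 PowerSeries.X * a by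
      obtain ⟨b, hb⟩ := this
      exact ⟨b, by rw [← mul_assoc, ← pow_two, ← hb]; abel⟩
    rw [hdvd]
    intro m
    obtain ⟨s, rfl⟩ := Ψ.surjective a
    rw [map_sub, skewCoeffHom_skewConst_mul, skewConst_apply, ← map_mul, skewCoeffHom_apply,
      skewCoeffHom_apply, SkewPowerSeries.coeff_mul_C]
    -- only the term `sₘ σᵐ(X)` of the sum is nonzero modulo `X²`
    have h2 := X_pow_dvd_tsum_sub_sum p (fun i => s.coeff (m + i) *
      skewCoeff (sigmaHom p ε) (deltaHom p ε) (m + i) PowerSeries.X m) (fun i => by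
        have h := X_pow_dvd_skewCoeff p ε hε (m + i) PowerSeries.X m
        rw [Nat.add_sub_cancel_left] at h
        exact h.mul_left _) 2
    have h3 := X_pow_add_dvd_skewCoeff p ε hε (k := 1) (r := PowerSeries.X) (by rw [pow_one])
      (m + 1) m
    rw [Nat.add_sub_cancel_left] at h3
    obtain ⟨w, hw⟩ := powSubOne_eq p (ε ^ m) (by rw [map_pow, hε, one_pow])
    rw [Finset.sum_range_succ, Finset.sum_range_one, add_zero, skewCoeff_self,
      sigmaHom_iterate_X p ε hε, ← powSubOne_eq_onePlusXPow_sub_one, hw] at h2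
    have h4 := dvd_add (dvd_add h2 (h3.mul_left (s.coeff (m + 1))))
      (Dvd.intro (s.coeff m * w) rfl : PowerSeries.X ^ 2 ∣ PowerSeries.X ^ 2 * (s.coeff m * w))
    convert! h4 using 1
    ring
  · intro a ha
    refine skewCoeffHom_ext Ψ fun n => ?_
    have h := congrArg (skewCoeffHom Ψ n) ha
    rw [skewCoeffHom_skewConst_mul, map_zero] at h
    rw [map_zero]
    exact (mul_eq_zero.mp h).resolve_left PowerSeries.X_ne_zero
  · intro a ha
    refine skewCoeffHom_ext Ψ fun n => ?_
    rw [map_zero]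
    ext d
    exact PowerSeries.X_pow_dvd_iff.mp ((hdvd (d + 1) a).mp (ha (d + 1)) n) d (Nat.lt_succ_self d)
  · intro q
    refine ⟨Ψ ⟨fun m => ∑' i, PowerSeries.X ^ i * skewCoeffHom Ψ m (q i)⟩, fun n => ?_⟩
    rw [hdvd]
    intro m
    rw [map_sub, skewCoeffHom_apply, map_sum]
    simp only [← map_pow, skewCoeffHom_skewConst_mul]
    exact X_pow_dvd_tsum_sub_sum p _ (fun i => dvd_mul_right _ _) n

end SkewRing

/-! ### Height-one primes and prime elements -/

namespace IsNormalUniformizer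

variable {A B : Type*} [Ring A] [CommRing B] {x : A} {π : A →+* B}

theorem mem_span_iff (h : IsNormalUniformizer x π) {y : A} :
    y ∈ TwoSidedIdeal.span {x} ↔ π y = 0 := by
  constructor
  · intro hy
    have hle : TwoSidedIdeal.span {x} ≤ TwoSidedIdeal.ker π := by
      rw [TwoSidedIdeal.span_le, Set.singleton_subset_iff]
      exact (TwoSidedIdeal.mem_ker π).mpr h.map_eq_zero
    exact (TwoSidedIdeal.mem_ker π).mp (hle hy)
  · intro hy
    obtain ⟨b, rfl⟩ := h.dvd_of_map_eq_zero y hy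
    exact TwoSidedIdeal.mul_mem_right _ _ _ (TwoSidedIdeal.subset_span rfl)

theorem isGeneratedByNormal_span (h : IsNormalUniformizer x π) :
    IsGeneratedByNormal (TwoSidedIdeal.span {x}) x := by
  constructor
  · intro y
    rw [h.mem_span_iff]
    constructor
    · exact h.dvd_of_map_eq_zero y
    · rintro ⟨b, rfl⟩
      rw [map_mul, h.map_eq_zero, zero_mul]
  · intro y
    rw [h.mem_span_iff]
    constructor
    · intro hy
      obtain ⟨b, rfl⟩ := h.dvd_of_map_eq_zero y hy
      obtain ⟨c, hc, -⟩ := h.exists_self_mul_eq_mul b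
      exact ⟨c, hc⟩
    · rintro ⟨b, rfl⟩
      rw [map_mul, h.map_eq_zero, mul_zero]

variable [IsDomain B]

theorem isPrimeTwoSided_span (h : IsNormalUniformizer x π) :
    IsPrimeTwoSided (TwoSidedIdeal.span {x}) := by
  constructor
  · intro htop
    have h1 := (TwoSidedIdeal.one_mem_iff _).mpr htop
    rw [h.mem_span_iff, map_one] at h1
    exact one_ne_zero h1
  · intro a b hab
    have h1 := hab 1
    rw [mul_one, h.mem_span_iff, map_mul] at h1
    rw [h.mem_span_iff, h.mem_span_iff]
    exact mul_eq_zero.mp h1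

theorem isPrimeTwoSided_bot (h : IsNormalUniformizer x π) :
    IsPrimeTwoSided (⊥ : TwoSidedIdeal A) := by
  have := h.isDomain
  constructor
  · intro htop
    have h1 := (TwoSidedIdeal.one_mem_iff _).mpr htop
    exact one_ne_zero ((TwoSidedIdeal.mem_bot A).mp h1)
  · intro a b hab
    have h1 := hab 1
    rw [mul_one] at h1
    exact (mul_eq_zero.mp ((TwoSidedIdeal.mem_bot A).mp h1)).imp
      (TwoSidedIdeal.mem_bot A).mpr (TwoSidedIdeal.mem_bot A).mpr

/-- If all nonzero primes contain `x`, then the primes that do not strictly contain `(x)` are `0`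
and `(x)`, so that `(x)` is the only prime of height one. -/
theorem isHeightOnePrime_iff (h : IsNormalUniformizer x π)
    (hmem : ∀ P : TwoSidedIdeal A, IsPrimeTwoSided P → P ≠ ⊥ → x ∈ P) (P : TwoSidedIdeal A) :
    IsHeightOnePrime P ↔ P = TwoSidedIdeal.span {x} := by
  have hle {Q : TwoSidedIdeal A} (hQ : IsPrimeTwoSided Q) (hQ0 : Q ≠ ⊥) :
      TwoSidedIdeal.span {x} ≤ Q := by
    rw [TwoSidedIdeal.span_le, Set.singleton_subset_iff]
    exact hmem Q hQ hQ0
  have hbot : (⊥ : TwoSidedIdeal A) < TwoSidedIdeal.span {x} := by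
    refine bot_lt_iff_ne_bot.mpr fun h0 => h.ne_zero ((TwoSidedIdeal.mem_bot A).mp ?_)
    rw [← h0]
    exact TwoSidedIdeal.subset_span rfl
  let O : {Q : TwoSidedIdeal A // IsPrimeTwoSided Q} := ⟨⊥, h.isPrimeTwoSided_bot⟩
  let S : {Q : TwoSidedIdeal A // IsPrimeTwoSided Q} := ⟨_, h.isPrimeTwoSided_span⟩
  have hO : Order.height O = 0 := Order.height_eq_zero.mpr fun Q _ => (bot_le : ⊥ ≤ Q.1)
  have hS : Order.height S = 1 := by
    apply le_antisymm
    · have : Order.height S ≤ ((1 : ℕ) : ℕ∞) := by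
        rw [Order.height_le_coe_iff]
        intro Q hQ
        have hQ0 : Q = O := by
          by_contra hne
          have := hle Q.2 fun h0 => hne (Subtype.ext h0)
          exact hQ.not_ge this
        rw [hQ0, hO]
        exact_mod_cast one_pos
      exact_mod_cast this
    · have := Order.height_add_one_le (show O < S from hbot)
      rwa [hO, zero_add] at this
  constructor
  · rintro ⟨hP, hht⟩
    have hP0 : P ≠ ⊥ := by
      rintro rfl
      have : Order.height O = 1 := hht
      rw [hO] at this
      exact zero_ne_one this
    by_contra hne
    have hlt : S < ⟨P, hP⟩ := lt_of_le_of_ne (hle hP hP0) fun h0 =>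
      hne (congrArg Subtype.val h0).symm
    have := Order.height_add_one_le hlt
    rw [hS, hht] at this
    exact absurd this (by decide)
  · rintro rfl
    exact ⟨_, hS⟩

theorem isDomain_quotient_span (h : IsNormalUniformizer x π) :
    IsDomain (TwoSidedIdeal.span {x}).ringCon.Quotient := by
  have hmk (a : A) : (TwoSidedIdeal.span {x}).ringCon.mk' a = 0 ↔ π a = 0 := by
    rw [← h.mem_span_iff, ← TwoSidedIdeal.mem_ker, TwoSidedIdeal.ker_ringCon_mk']
  have hsurj := (TwoSidedIdeal.span {x}).ringCon.mk'_surjective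
  have hnt : Nontrivial (TwoSidedIdeal.span {x}).ringCon.Quotient := by
    refine ⟨⟨0, 1, fun h01 => ?_⟩⟩
    have h1 := (hmk 1).mp (by rw [map_one, h01])
    rw [map_one] at h1
    exact one_ne_zero h1
  have : NoZeroDivisors (TwoSidedIdeal.span {x}).ringCon.Quotient := by
    refine ⟨fun {a b} hab => ?_⟩
    obtain ⟨a, rfl⟩ := hsurj a
    obtain ⟨b, rfl⟩ := hsurj b
    rw [← map_mul, hmk, map_mul] at hab
    rw [hmk, hmk]
    exact mul_eq_zero.mp hab
  exact NoZeroDivisors.to_isDomain _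

/-- A prime element `a` divides `x` on both sides, and `(x)` is completely prime. -/
theorem exists_unit_of_isPrimeElement (h : IsNormalUniformizer x π)
    (hmem : ∀ P : TwoSidedIdeal A, IsPrimeTwoSided P → P ≠ ⊥ → x ∈ P) {a : A}
    (ha : IsPrimeElement a) : ∃ u : Aˣ, a = x * u := by
  have := h.isDomain
  obtain ⟨ha0, P, hP, hPa⟩ := ha
  have haP : a ∈ P := (hPa.1 a).mpr ⟨1, (mul_one a).symm⟩
  have hP0 : P ≠ ⊥ := by
    rintro rfl
    exact ha0 ((TwoSidedIdeal.mem_bot A).mp haP)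
  obtain ⟨b, hb⟩ := (hPa.1 x).mp (hmem P hP hP0)
  have hab : π a * π b = 0 := by rw [← map_mul, ← hb, h.map_eq_zero]
  rcases mul_eq_zero.mp hab with h0 | h0
  · obtain ⟨c, hc⟩ := h.dvd_of_map_eq_zero a h0
    have hcb : c * b = 1 := by
      apply mul_left_cancel₀ h.ne_zero
      rw [← mul_assoc, ← hc, ← hb, mul_one]
    have hbc : b * c = 1 := by
      apply mul_left_cancel₀ ha0
      rw [← mul_assoc, ← hb, ← hc, mul_one]
    exact ⟨⟨c, b, hcb, hbc⟩, hc⟩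
  · -- otherwise `b = c x` and `x = a c x`, so that `a` is invertible
    exfalso
    obtain ⟨c, hc⟩ := (h.isGeneratedByNormal_span.2 b).mp (h.mem_span_iff.mpr h0)
    have hac : a * c = 1 := by
      apply mul_right_cancel₀ h.ne_zero
      rw [mul_assoc, ← hc, ← hb, one_mul]
    refine hP.1 ((TwoSidedIdeal.one_mem_iff P).mp ?_)
    rw [← hac]
    exact P.mul_mem_right _ _ haP

theorem isPrimeElement_self_mul_unit (h : IsNormalUniformizer x π) (u : Aˣ) :
    IsPrimeElement (x * (u : A)) := by
  have := h.isDomain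
  refine ⟨mul_ne_zero h.ne_zero u.ne_zero, _, h.isPrimeTwoSided_span, ?_, ?_⟩
  · intro y
    rw [h.isGeneratedByNormal_span.1]
    constructor
    · rintro ⟨b, rfl⟩
      exact ⟨((u⁻¹ : Aˣ) : A) * b, by rw [mul_assoc, Units.mul_inv_cancel_left]⟩
    · rintro ⟨b, rfl⟩
      exact ⟨(u : A) * b, mul_assoc _ _ _⟩
  · intro y
    rw [h.mem_span_iff]
    constructor
    · intro hy
      obtain ⟨b, hb⟩ := (h.isGeneratedByNormal_span.2 (y * ((u⁻¹ : Aˣ) : A))).mp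
        (h.mem_span_iff.mpr (by rw [map_mul, hy, zero_mul]))
      exact ⟨b, by rw [← mul_assoc, ← hb, Units.inv_mul_cancel_right]⟩
    · rintro ⟨b, rfl⟩
      rw [map_mul, map_mul, h.map_eq_zero, zero_mul, mul_zero]

/-- Multiples of `x` by units on the left and on the right are the same elements. -/
theorem exists_unit_mul_self_iff (h : IsNormalUniformizer x π) (a : A) :
    (∃ u : Aˣ, a = u * x) ↔ ∃ u : Aˣ, a = x * u := by
  have := h.isDomain
  constructor
  · rintro ⟨u, rfl⟩
    obtain ⟨c, hc, -⟩ := h.exists_mul_eq_mul_self (u : A)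
    obtain ⟨d, hd, -⟩ := h.exists_mul_eq_mul_self ((u⁻¹ : Aˣ) : A)
    refine ⟨⟨c, d, ?_, ?_⟩, hc⟩
    · apply mul_left_cancel₀ h.ne_zero
      rw [← mul_assoc, ← hc, mul_assoc, ← hd, Units.mul_inv_cancel_left, mul_one]
    · apply mul_left_cancel₀ h.ne_zero
      rw [← mul_assoc, ← hd, mul_assoc, ← hc, Units.inv_mul_cancel_left, mul_one]
  · rintro ⟨u, rfl⟩
    obtain ⟨c, hc, -⟩ := h.exists_self_mul_eq_mul (u : A)
    obtain ⟨d, hd, -⟩ := h.exists_self_mul_eq_mul ((u⁻¹ : Aˣ) : A)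
    refine ⟨⟨c, d, ?_, ?_⟩, hc⟩
    · apply mul_right_cancel₀ h.ne_zero
      rw [mul_assoc, ← hd, ← mul_assoc, ← hc, Units.mul_inv_cancel_right, one_mul]
    · apply mul_right_cancel₀ h.ne_zero
      rw [mul_assoc, ← hc, ← mul_assoc, ← hd, Units.inv_mul_cancel_right, one_mul]

theorem isPrimeElement_iff (h : IsNormalUniformizer x π)
    (hmem : ∀ P : TwoSidedIdeal A, IsPrimeTwoSided P → P ≠ ⊥ → x ∈ P) (a : A) :
    IsPrimeElement a ↔ ∃ u : Aˣ, a = x * u := by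
  constructor
  · exact h.exists_unit_of_isPrimeElement hmem
  · rintro ⟨u, rfl⟩
    exact h.isPrimeElement_self_mul_unit u

theorem isChattersUFD [IsPrincipalIdealRing B] (h : IsNormalUniformizer x π)
    (hmem : ∀ P : TwoSidedIdeal A, IsPrimeTwoSided P → P ≠ ⊥ → x ∈ P) : IsChattersUFD A where
  isDomain := h.isDomain
  isNoetherian_left := h.isNoetherianRing
  isNoetherian_right := h.op.isNoetherianRing
  exists_heightOne := ⟨_, (h.isHeightOnePrime_iff hmem _).mpr rfl⟩
  principal P hP := by
    rw [(h.isHeightOnePrime_iff hmem P).mp hP]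
    exact ⟨x, h.isGeneratedByNormal_span⟩
  isDomain_quotient P hP := by
    rw [(h.isHeightOnePrime_iff hmem P).mp hP]
    exact h.isDomain_quotient_span

end IsNormalUniformizer

/-! ### The action on `𝔽_p[[X]]` has infinite order -/

section Action

variable {p : ℕ} [Fact p.Prime] {ρ : Multiplicative ℤ_[p] →ₜ* ℤ_[p]ˣ}

/-- An action of `ℤ_p` on `ℤ_p` is trivial if `1` acts trivially, because the integers are dense. -/
theorem action_eq_one_of_action_one_eq_one (h1 : ρ (Multiplicative.ofAdd 1) = 1) (b : ℤ_[p]) :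
    ρ (Multiplicative.ofAdd b) = 1 := by
  have hcont : Continuous fun b : ℤ_[p] => ρ (Multiplicative.ofAdd b) :=
    ρ.continuous_toFun.comp continuous_ofAdd
  have hnat : (fun b : ℤ_[p] => ρ (Multiplicative.ofAdd b)) ∘ (Nat.cast : ℕ → ℤ_[p]) =
      (fun _ => 1) ∘ (Nat.cast : ℕ → ℤ_[p]) := by
    funext n
    have : Multiplicative.ofAdd (n : ℤ_[p]) = Multiplicative.ofAdd 1 ^ n := by
      rw [← ofAdd_nsmul, nsmul_eq_mul, mul_one]
    simp only [Function.comp_apply, this, map_pow, h1, one_pow]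
  exact congrFun (PadicInt.denseRange_natCast.equalizer hcont continuous_const hnat) b

theorem action_one_ne_one {G : Type*} [Group G] [TopologicalSpace G] (e : G ≃ₜ* PadicSemidirect p ρ)
    (hG : ∃ g h : G, g * h ≠ h * g) : ρ (Multiplicative.ofAdd 1) ≠ 1 := by
  intro h1
  obtain ⟨g, h, hgh⟩ := hG
  apply hgh
  apply e.injective
  have hρ := action_eq_one_of_action_one_eq_one h1
  refine SemidirectProduct.ext ?_ ?_
  · have key := leftCoord_mul e g h
    have key' := leftCoord_mul e h g
    rw [hρ, Units.val_one, one_mul] at key key'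
    exact Multiplicative.toAdd.injective (key.trans ((add_comm _ _).trans key'.symm))
  · exact Multiplicative.toAdd.injective
      ((rightCoord_mul e g h).trans ((add_comm _ _).trans (rightCoord_mul e h g).symm))

theorem sigmaHom_iterate_X_injective {ε : ℤ_[p]} (hε : PadicInt.toZMod ε = 1) (h1 : ε ≠ 1)
    (h2 : p = 2 → ε ≠ -1) : Function.Injective fun n : ℕ => (sigmaHom p ε)^[n] PowerSeries.X := by
  have hε0 : ε ≠ 0 := by
    rintro rfl
    simp at hε
  have key {m n : ℕ} (hmn : m < n) : ε ^ m ≠ ε ^ n := by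
    intro h
    obtain ⟨d, rfl⟩ := Nat.exists_eq_add_of_lt hmn
    rw [add_assoc, pow_add] at h
    exact h1 (eq_one_of_pow_eq_one hε h2 (Nat.succ_ne_zero d)
      (mul_left_cancel₀ (pow_ne_zero m hε0) (by rw [mul_one]; exact h.symm)))
  intro m n hmn
  simp only [sigmaHom_iterate_X p ε hε] at hmn
  have h3 := onePlusXPow_injective p (sub_left_injective hmn)
  rcases lt_trichotomy m n with h | h | h
  · exact absurd h3 (key h)
  · exact h
  · exact absurd h3.symm (key h)

end Action

/-! ### Unique factorisation in `𝔽_p[[G]]` -/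

theorem mainTheorem6 (p : ℕ) [Fact p.Prime] (ρ : Multiplicative ℤ_[p] →ₜ* ℤ_[p]ˣ)
    (hρ : p = 2 → ρ (Multiplicative.ofAdd 1) ≠ -1)
    (G : Type*) [Group G] [TopologicalSpace G] (e : G ≃ₜ* PadicSemidirect p ρ)
    (hG : ∃ g h : G, g * h ≠ h * g)
    (γ₁ γ₂ : G) (hγ₁ : e γ₁ = SemidirectProduct.inl (Multiplicative.ofAdd 1))
    (hγ₂ : e γ₂ = SemidirectProduct.inr (Multiplicative.ofAdd 1))
    (ε : ℤ_[p]) (hε : ε = ρ (Multiplicative.ofAdd 1))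
    (X Y : CompletedGroupAlgebra (ZMod p) G)
    (hX : X = CompletedGroupAlgebra.of (ZMod p) γ₁ - 1)
    (hY : Y = CompletedGroupAlgebra.of (ZMod p) γ₂ - 1) :
    (∃ Φ : CompletedGroupAlgebra (ZMod p) G ≃+* SkewFpSeries p ε,
      Φ X = SkewPowerSeries.C _ _ PowerSeries.X ∧ Φ Y = SkewPowerSeries.Y _ _) ∧
    IsChattersUFD (CompletedGroupAlgebra (ZMod p) G) ∧
    (∀ P : TwoSidedIdeal (CompletedGroupAlgebra (ZMod p) G),
      IsHeightOnePrime P ↔ P = TwoSidedIdeal.span {X}) ∧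
    (∀ a : CompletedGroupAlgebra (ZMod p) G,
      IsPrimeElement a ↔ ∃ u : (CompletedGroupAlgebra (ZMod p) G)ˣ, a = u * X) ∧
    (∀ a : CompletedGroupAlgebra (ZMod p) G,
      IsPrimeElement a ↔ ∃ u : (CompletedGroupAlgebra (ZMod p) G)ˣ, a = X * u) := by
  have hε1 : PadicInt.toZMod ε = 1 := toZMod_eq_one_of_eq_action hε
  obtain ⟨Ψ, hΨX, hΨ1, hΨY⟩ : ∃ Ψ : SkewFpSeries p ε ≃+* CompletedGroupAlgebra (ZMod p) G,
      Ψ (SkewPowerSeries.C _ _ PowerSeries.X) = X ∧ Ψ (SkewPowerSeries.C _ _ 1) = 1 ∧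
      Ψ (SkewPowerSeries.Y _ _) = Y :=
    ⟨completedEvalEquiv e hγ₁ hγ₂ hε, by rw [completedEvalEquiv_C_X, hX],
      completedEvalEquiv_C_one e hγ₁ hγ₂ hε, by rw [completedEvalEquiv_Y, hY]⟩
  have h := isNormalUniformizer_skewConst_X Ψ hΨ1 hε1
  rw [skewConst_apply, hΨX] at h
  have hinj : Function.Injective fun n : ℕ => (sigmaHom p ε)^[n] PowerSeries.X := by
    refine sigmaHom_iterate_X_injective hε1 (fun h0 => action_one_ne_one e hG ?_) fun hp h0 =>
      hρ hp ?_
    · exact Units.ext (by rw [← hε, h0, Units.val_one])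
    · exact Units.ext (by rw [← hε, h0, Units.val_neg, Units.val_one])
  have hunit : IsUnit (1 + Ψ (SkewPowerSeries.Y _ _)) := by
    rw [hΨY, hY, add_sub_cancel]
    exact CompletedGroupAlgebra.isUnit_of γ₂
  have hmem (P : TwoSidedIdeal (CompletedGroupAlgebra (ZMod p) G)) (hP : IsPrimeTwoSided P)
      (hP0 : P ≠ ⊥) : X ∈ P := by
    refine h.mem_of_isPrimeTwoSided (ev := skewConst Ψ hΨ1) hΨX (fun a => ?_) ?_ hunit
      (one_add_Y_mul_skewConst Ψ hΨ1) hinj hP hP0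
    · rw [skewReduction_skewConst, PowerSeries.constantCoeff_C]
    · rw [map_add, map_one, skewReduction_Y]
  refine ⟨⟨Ψ.symm, ?_, ?_⟩, h.isChattersUFD hmem, h.isHeightOnePrime_iff hmem, fun a => ?_,
    h.isPrimeElement_iff hmem⟩
  · rw [← hΨX, RingEquiv.symm_apply_apply]
  · rw [← hΨY, RingEquiv.symm_apply_apply]
  · rw [h.isPrimeElement_iff hmem, h.exists_unit_mul_self_iff]
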